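/- Let $\Phi,\xi:\mathbb{R}\to\mathbb{R}$ be smooth convex functions with $\Phi(-x)=\Phi(x)$, $\xi(-x)=\xi(x)$ and $\Phi(0)=\xi(0)=0$. Assume that $\Phi$ is of moderate growth in the sense that $\mathbb{E}\exp(c\,\Phi(Z))<\infty$ for some $c>1$, where $Z$ is a centred Gaussian variable with variance $\xi'(1)$. Let $h\in\mathbb{R}$, $k\ge 1$ and $0=q_0\le q_1\le\dots\le q_k\le q_{k+1}=1$. Let $z_0,\dots,z_k$ be independent centred Gaussian variables with $\mathbb{E}z_l^2=\xi'(q_{l+1})-\xi'(q_l)$. For $\vec m=(m_0,\dots,m_k)$ put $\Phi_{k+1}=\Phi$ and, for $l=k,k-1,\dots,0$, $$\Phi_l(x)=\frac1{m_l}\log\mathbb{E}\exp\bigl(m_l\,\Phi_{l+1}(x+z_l)\bigr),$$ which for $m_l=0$ means $\Phi_l(x)=\mathbb{E}\,\Phi_{l+1}(x+z_l)$. Let $\mathcal{P}_k(\vec m)=\mathcal{P}_k(\vec m,\vec q)=\Phi_0(h)$. Let $0=m_0\le m_1\le\dots\le m_k=1$ and $0=n_0\le n_1\le\dots\le n_k=1$,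 and suppose that $n_j\le m_j$ for all $j$, or $n_j\ge m_j$ for all $j$. Then the partial derivatives $\frac{\partial\mathcal{P}_k}{\partial m_j}(\vec m)$, $0\le j\le k$, exist and $$\mathcal{P}_k(\vec n)-\mathcal{P}_k(\vec m)\ \ge\ \nabla\mathcal{P}_k(\vec m)\cdot(\vec n-\vec m)=\sum_{0\le j\le k}\frac{\partial\mathcal{P}_k}{\partial m_j}(\vec m)\,(n_j-m_j).$$ -/

import Mathlib

open MeasureTheory ProbabilityTheory
open scoped NNReal ContDiff

noncomputable section

/-- One step of the recursion: for `z` a centred Gaussian variable of variance `v`, this is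
`x ↦ (1 / a) * log E exp (a * F (x + z))` if `a ≠ 0`, and `x ↦ E F (x + z)` if `a = 0`. -/
def parisiStep (a : ℝ) (v : ℝ≥0) (F : ℝ → ℝ) (x : ℝ) : ℝ :=
  if a = 0 then ∫ z, F (x + z) ∂(gaussianReal 0 v)
  else (1 / a) * Real.log (∫ z, Real.exp (a * F (x + z)) ∂(gaussianReal 0 v))

/-- The function obtained from the terminal function `Φ` by the backward recursion with `r` steps,
with parameters `m 0, …, m (r - 1)` and `q 0, …, q r`. The outermost (last performed) step has
parameter `m 0` and variance `ξ' (q 1) - ξ' (q 0)`, the innermost one has parameter `m (r - 1)`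
and variance `ξ' (q r) - ξ' (q (r - 1))`. -/
def parisiRec (Φ ξ : ℝ → ℝ) : (r : ℕ) → (Fin r → ℝ) → (Fin (r + 1) → ℝ) → ℝ → ℝ
  | 0, _, _ => Φ
  | r + 1, m, q =>
      parisiStep (m 0) (Real.toNNReal (deriv ξ (q 1) - deriv ξ (q 0)))
        (parisiRec Φ ξ r (fun i => m i.succ) (fun i => q i.succ))

/-- The Parisi functional `P_k(m, q) = Φ_0(h)` of a step function, as a function of arbitrary real
vectors `m = (m_0, …, m_k)` and `q = (q_0, …, q_{k+1})`. -/
def parisiP (Φ ξ : ℝ → ℝ) (h : ℝ) (k : ℕ) (m : Fin (k + 1) → ℝ) (q : Fin (k + 2) → ℝ) : ℝ :=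
  parisiRec Φ ξ (k + 1) m q h

/-- The partial derivative of `P_k` with respect to `m_j` at `m`. -/
def parisiPartial (Φ ξ : ℝ → ℝ) (h : ℝ) (k : ℕ) (m : Fin (k + 1) → ℝ) (q : Fin (k + 2) → ℝ)
    (j : Fin (k + 1)) : ℝ :=
  deriv (fun t : ℝ => parisiP Φ ξ h k (Function.update m j t) q) (m j)

/-- Admissible parameters `0 = m_0 ≤ m_1 ≤ … ≤ m_k = 1`. -/
def IsParisiM (k : ℕ) (m : Fin (k + 1) → ℝ) : Prop :=
  m 0 = 0 ∧ Monotone m ∧ m (Fin.last k) = 1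

/-- Admissible parameters `0 = q_0 ≤ q_1 ≤ … ≤ q_k ≤ q_{k+1} = 1`. -/
def IsParisiQ (k : ℕ) (q : Fin (k + 2) → ℝ) : Prop :=
  q 0 = 0 ∧ Monotone q ∧ q (Fin.last (k + 1)) = 1

/-- Smooth, convex, symmetric, and zero at the origin. -/
structure IsSmoothConvexSymm (f : ℝ → ℝ) : Prop where
  smooth : ContDiff ℝ ∞ f
  convex : ConvexOn ℝ Set.univ f
  symm : ∀ x, f (-x) = f x
  zero : f 0 = 0

/-- Moderate growth of `Φ` (relative to `ξ`): `E exp (c * Φ Z) < ∞` for some `c > 1`, where `Z` is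
a centred Gaussian variable with the total variance `ξ' 1` of the increments. -/
def ModerateGrowth (Φ ξ : ℝ → ℝ) : Prop :=
  ∃ c : ℝ, 1 < c ∧
    Integrable (fun z => Real.exp (c * Φ z)) (gaussianReal 0 (Real.toNNReal (deriv ξ 1)))

end

/-! Two properties of the map from `m` to `P_k(m)` on nonnegative parameters carry the theorem: it
has increasing differences (raising one `m_j` gains more when the other parameters are larger), and
it is convex in each `m_j` separately. If `m` and `n` are ordered, one passes from `m` to `n` one
coordinate at a time; increasing differences then bound the total increment below by the sum of the
single-coordinate increments started at `m` (`sum_update_sub_le`), and convexity bounds each of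
these below by its tangent at `m_j`.

Increasing differences propagate through a step by `logMean_sub_le_sub`, which combines the power
mean inequality with Chebyshev's association inequality. Chebyshev needs functions increasing in
`|x|`. Chains are such functions, being even and convex. Differences of chains with ordered
parameters are such functions by the Cameron–Martin formula: against an even integrand a shift by
`x` becomes the weight `cosh (x z / v)`, and the ratio of two such weights is monotone in `|z|`.

Convexity in one parameter is deduced from increasing differences
(`LipEvenConvex.parisiStep_le_convex`). A step of variance `v` is a chain of `N` steps of variance
`v / N` with the same parameter. A short step is affine in its parameter up to an error of order `(v
/ N) ^ (3 / 2)`, and changing all `N` parameters at once gains at least the sum of the `N` separate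
gains. The total convexity defect is thus of order `N ^ (-1 / 2)` and vanishes in the limit.

All this is done for Lipschitz terminal functions; moderate growth allows passage to the limit.
Differentiability is proved for `Φ` itself. At `m_j > 0`, convexity and monotonicity in the
parameter dominate the difference quotients, with room because `m_j ≤ 1 < c`. At `m_j = 0` all
earlier parameters vanish as well, so the outer steps are plain expectations and an explicit
Lipschitz bound, valid also for negative values of the parameter, goes through them. -/

/-! ### Normalised cumulants on a probability space. -/

/-- The normalised cumulant `(1 / a) * log E exp (a * f)`, read as `E f` when `a = 0`. -/
noncomputable def logMean {Ω : Type*} [MeasurableSpace Ω] (μ : Measure Ω) (a : ℝ) (f : Ω → ℝ) : ℝ :=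
  if a = 0 then ∫ z, f z ∂μ else (1 / a) * Real.log (∫ z, Real.exp (a * f z) ∂μ)

/-- Integrability of `f` and of `exp (a * f)`. -/
def ExpIntegrable {Ω : Type*} [MeasurableSpace Ω] (μ : Measure Ω) (a : ℝ) (f : Ω → ℝ) : Prop :=
  Integrable f μ ∧ Integrable (fun z => Real.exp (a * f z)) μ

section LogMean

variable {Ω : Type*} [MeasurableSpace Ω] {μ : Measure Ω}

lemma integrable_exp_sub_const {a : ℝ} {f : Ω → ℝ} (c : ℝ)
    (hf : Integrable (fun z => Real.exp (a * f z)) μ) :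
    Integrable (fun z => Real.exp (a * (f z - c))) μ := by
  have h : ∀ z, Real.exp (a * (f z - c)) = Real.exp (a * f z) * (Real.exp (a * c))⁻¹ := by
    intro z; rw [← Real.exp_neg, ← Real.exp_add]; congr 1; ring
  simp_rw [h]
  exact hf.mul_const _

/-- Weighted power mean inequality, in normalised form. -/
lemma exp_mul_integral_le_of_le {a b c : ℝ} (ha : 0 < a) (hab : a ≤ b) {p d : Ω → ℝ}
    (hp : ∀ z, 0 ≤ p z) (hp1 : Integrable p μ)
    (hpa : Integrable (fun z => p z * Real.exp (a * d z)) μ)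
    (hpb : Integrable (fun z => p z * Real.exp (b * d z)) μ)
    (h : ∫ z, p z * Real.exp (a * d z) ∂μ = Real.exp (a * c) * ∫ z, p z ∂μ) :
    Real.exp (b * c) * ∫ z, p z ∂μ ≤ ∫ z, p z * Real.exp (b * d z) ∂μ := by
  have key : ∀ z, Real.exp (b * c) * (p z + (b / a) *
      (Real.exp (-(a * c)) * (p z * Real.exp (a * d z)) - p z)) ≤ p z * Real.exp (b * d z) := by
    intro z
    -- Bernoulli's inequality with exponent `b / a ≥ 1`. Its linear term integrates to zero against
    -- `p` by the normalisation `h`.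
    have h1 : 1 + (b / a) * (Real.exp (a * (d z - c)) - 1) ≤ Real.exp (b * (d z - c)) := by
      have hb : 1 ≤ b / a := (one_le_div ha).2 hab
      have := one_add_mul_self_le_rpow_one_add (s := Real.exp (a * (d z - c)) - 1)
        (by linarith [Real.exp_pos (a * (d z - c))]) hb
      refine this.trans (le_of_eq ?_)
      rw [add_sub_cancel, ← Real.exp_mul]
      congr 1; field_simp
    have h2 : Real.exp (-(a * c)) * Real.exp (a * d z) = Real.exp (a * (d z - c)) := by
      rw [← Real.exp_add]; congr 1; ring
    have h3 : Real.exp (b * c) * Real.exp (b * (d z - c)) = Real.exp (b * d z) := by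
      rw [← Real.exp_add]; congr 1; ring
    calc _ = (p z * Real.exp (b * c)) * (1 + (b / a) * (Real.exp (a * (d z - c)) - 1)) := by
          rw [← h2]; ring
      _ ≤ (p z * Real.exp (b * c)) * Real.exp (b * (d z - c)) :=
          mul_le_mul_of_nonneg_left h1 (mul_nonneg (hp z) (Real.exp_pos _).le)
      _ = _ := by rw [← h3]; ring
  have i1 : Integrable (fun z => (b / a) *
      (Real.exp (-(a * c)) * (p z * Real.exp (a * d z)) - p z)) μ :=
    ((hpa.const_mul _).sub hp1).const_mul _
  have := integral_mono ((hp1.add i1).const_mul (Real.exp (b * c))) hpb key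
  refine le_trans (le_of_eq ?_) this
  simp only [Pi.add_apply]
  rw [integral_const_mul, integral_add hp1 i1, integral_const_mul,
    integral_sub (hpa.const_mul _) hp1, integral_const_mul, h, ← mul_assoc, ← Real.exp_add]
  simp

variable [IsProbabilityMeasure μ]

lemma exp_mul_logMean {a : ℝ} (ha : a ≠ 0) {f : Ω → ℝ}
    (hf : Integrable (fun z => Real.exp (a * f z)) μ) :
    Real.exp (a * logMean μ a f) = ∫ z, Real.exp (a * f z) ∂μ := by
  have hpos : 0 < ∫ z, Real.exp (a * f z) ∂μ := integral_exp_pos hf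
  rw [logMean, if_neg ha, ← mul_assoc, mul_one_div_cancel ha, one_mul, Real.exp_log hpos]

lemma integral_exp_sub_logMean {a : ℝ} (ha : a ≠ 0) {f : Ω → ℝ}
    (hf : Integrable (fun z => Real.exp (a * f z)) μ) :
    ∫ z, Real.exp (a * (f z - logMean μ a f)) ∂μ = 1 := by
  have h : ∀ z, Real.exp (a * (f z - logMean μ a f))
      = Real.exp (a * f z) * (Real.exp (a * logMean μ a f))⁻¹ := by
    intro z; rw [← Real.exp_neg, ← Real.exp_add]; congr 1; ring
  simp_rw [h]
  rw [integral_mul_const, ← exp_mul_logMean ha hf, mul_inv_cancel₀ (Real.exp_pos _).ne']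

lemma logMean_le_of_integral_le {a : ℝ} (ha : 0 < a) {f : Ω → ℝ}
    (hf : Integrable (fun z => Real.exp (a * f z)) μ) {c : ℝ}
    (h : ∫ z, Real.exp (a * f z) ∂μ ≤ Real.exp (a * c)) : logMean μ a f ≤ c := by
  rw [← exp_mul_logMean ha.ne' hf, Real.exp_le_exp] at h
  exact le_of_mul_le_mul_left h ha

lemma le_logMean_of_le_integral {a : ℝ} (ha : 0 < a) {f : Ω → ℝ}
    (hf : Integrable (fun z => Real.exp (a * f z)) μ) {c : ℝ}
    (h : Real.exp (a * c) ≤ ∫ z, Real.exp (a * f z) ∂μ) : c ≤ logMean μ a f := by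
  rw [← exp_mul_logMean ha.ne' hf, Real.exp_le_exp] at h
  exact le_of_mul_le_mul_left h ha

/-- Convexity of `logMean` in the function, with an additive error. -/
lemma logMean_le_convex {a : ℝ} (ha : 0 ≤ a) {f g h : Ω → ℝ} (hf : ExpIntegrable μ a f)
    (hg : ExpIntegrable μ a g) (hh : ExpIntegrable μ a h) {α β ε : ℝ} (hα : 0 ≤ α) (hβ : 0 ≤ β)
    (hαβ : α + β = 1) (hle : ∀ z, h z ≤ α * f z + β * g z + ε) :
    logMean μ a h ≤ α * logMean μ a f + β * logMean μ a g + ε := by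
  rcases ha.eq_or_lt with rfl | ha
  · simp only [logMean, if_true]
    have h1 : Integrable (fun z => α * f z) μ := hf.1.const_mul α
    have h2 : Integrable (fun z => β * g z) μ := hg.1.const_mul β
    have h12 : Integrable (fun z => α * f z + β * g z) μ := h1.add h2
    calc ∫ z, h z ∂μ ≤ ∫ z, (α * f z + β * g z + ε) ∂μ :=
          integral_mono hh.1 (h12.add (integrable_const ε)) hle
      _ = _ := by
          rw [integral_add h12 (integrable_const ε), integral_add h1 h2,
            integral_const_mul, integral_const_mul]
          simp
  · set F := logMean μ a f
    set G := logMean μ a g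
    apply logMean_le_of_integral_le ha hh.2
    have e1 := (integrable_exp_sub_const F hf.2).const_mul α
    have e2 := (integrable_exp_sub_const G hg.2).const_mul β
    -- Centring `f` and `g` at their own log-means makes both exponential integrals equal to `1`, so
    -- convexity of `exp` does the work of Hölder's inequality.
    have key : ∀ z, Real.exp (a * h z) ≤ Real.exp (a * (α * F + β * G + ε)) *
        (α * Real.exp (a * (f z - F)) + β * Real.exp (a * (g z - G))) := by
      intro z
      have hc := convexOn_exp.2 (Set.mem_univ (a * (f z - F))) (Set.mem_univ (a * (g z - G)))
        hα hβ hαβ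
      simp only [smul_eq_mul] at hc
      refine le_trans ?_ (mul_le_mul_of_nonneg_left hc (Real.exp_pos _).le)
      rw [← Real.exp_add, Real.exp_le_exp]
      nlinarith [hle z]
    calc ∫ z, Real.exp (a * h z) ∂μ ≤ ∫ z, Real.exp (a * (α * F + β * G + ε)) *
        (α * Real.exp (a * (f z - F)) + β * Real.exp (a * (g z - G))) ∂μ :=
          integral_mono hh.2 ((e1.add e2).const_mul _) key
      _ = Real.exp (a * (α * F + β * G + ε)) := by
          rw [integral_const_mul, integral_add e1 e2, integral_const_mul, integral_const_mul,
            integral_exp_sub_logMean ha.ne' hf.2, integral_exp_sub_logMean ha.ne' hg.2]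
          rw [mul_one, mul_one, hαβ, mul_one]

lemma logMean_le_add {a : ℝ} (ha : 0 ≤ a) {f h : Ω → ℝ} (hf : ExpIntegrable μ a f)
    (hh : ExpIntegrable μ a h) {ε : ℝ} (hle : ∀ z, h z ≤ f z + ε) :
    logMean μ a h ≤ logMean μ a f + ε := by
  have := logMean_le_convex ha hf hf hh (α := 1) (β := 0) (ε := ε) zero_le_one le_rfl (by norm_num)
    (by simpa using hle)
  simpa using this

lemma logMean_mono {a : ℝ} (ha : 0 ≤ a) {f h : Ω → ℝ} (hf : ExpIntegrable μ a f)
    (hh : ExpIntegrable μ a h) (hle : ∀ z, h z ≤ f z) : logMean μ a h ≤ logMean μ a f := by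
  simpa using logMean_le_add ha hf hh (ε := 0) (by simpa using hle)

lemma logMean_const (a c : ℝ) : logMean μ a (fun _ => c) = c := by
  by_cases ha : a = 0
  · simp [logMean, ha]
  · simp [logMean, ha]

/-- Jensen's inequality, obtained by integrating the tangent line of the exponential at the mean. -/
lemma integral_le_logMean {b : ℝ} (hb : 0 ≤ b) {f : Ω → ℝ} (hf : ExpIntegrable μ b f) :
    ∫ z, f z ∂μ ≤ logMean μ b f := by
  rcases hb.eq_or_lt with rfl | hb
  · simp [logMean]
  set c := ∫ z, f z ∂μ with hc
  apply le_logMean_of_le_integral hb hf.2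
  have key : ∀ z, Real.exp (b * c) * (1 + b * (f z - c)) ≤ Real.exp (b * f z) := by
    intro z
    have h1 := Real.add_one_le_exp (b * (f z - c))
    have h3 : Real.exp (b * c) * Real.exp (b * (f z - c)) = Real.exp (b * f z) := by
      rw [← Real.exp_add]; congr 1; ring
    rw [← h3]
    exact mul_le_mul_of_nonneg_left (by linarith) (Real.exp_pos _).le
  have i2 : Integrable (fun z => f z - c) μ := hf.1.sub (integrable_const c)
  have i1 : Integrable (fun z => b * (f z - c)) μ := i2.const_mul b
  have := integral_mono (((integrable_const (1:ℝ)).add i1).const_mul (Real.exp (b * c))) hf.2 key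
  refine le_trans (le_of_eq ?_) this
  simp only [Pi.add_apply]
  rw [integral_const_mul, integral_add (integrable_const _) i1, integral_const_mul,
    integral_sub hf.1 (integrable_const c)]
  simp [← hc]

/-- The power mean inequality. -/
lemma logMean_mono_exponent {a b : ℝ} (ha : 0 ≤ a) (hab : a ≤ b) {f : Ω → ℝ}
    (hfa : ExpIntegrable μ a f) (hfb : ExpIntegrable μ b f) :
    logMean μ a f ≤ logMean μ b f := by
  rcases ha.eq_or_lt with rfl | ha
  · simpa [logMean] using integral_le_logMean hab hfb
  apply le_logMean_of_le_integral (ha.trans_le hab) hfb.2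
  have := exp_mul_integral_le_of_le (μ := μ) (c := logMean μ a f) ha hab (p := fun _ => 1) (d := f)
    (fun _ => zero_le_one) (integrable_const _) (by simpa using hfa.2) (by simpa using hfb.2)
    (by simpa using (exp_mul_logMean ha.ne' hfa.2).symm)
  simpa using this

/-- Chebyshev's association inequality for functions monotone in a common rank function. -/
lemma integral_mul_integral_le_of_comonotone {p f g : Ω → ℝ} (hp : ∀ z, 0 ≤ p z)
    (ρ : Ω → ℝ) (hf : ∀ u w, ρ u ≤ ρ w → f u ≤ f w) (hg : ∀ u w, ρ u ≤ ρ w → g u ≤ g w)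
    (ip : Integrable p μ) (ipf : Integrable (fun z => p z * f z) μ)
    (ipg : Integrable (fun z => p z * g z) μ)
    (ipfg : Integrable (fun z => p z * f z * g z) μ) :
    (∫ z, p z * f z ∂μ) * (∫ z, p z * g z ∂μ) ≤ (∫ z, p z ∂μ) * ∫ z, p z * f z * g z ∂μ := by
  -- The integrand is `p x₁ * p x₂ * (f x₁ - f x₂) * (g x₁ - g x₂)` expanded; comonotonicity makes
  -- it nonnegative on the product space.
  have h0 : 0 ≤ ∫ x : Ω × Ω, ((p x.1 * (p x.2 * f x.2 * g x.2) + (p x.1 * f x.1 * g x.1) * p x.2)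
      - ((p x.1 * f x.1) * (p x.2 * g x.2) + (p x.1 * g x.1) * (p x.2 * f x.2))) ∂(μ.prod μ) := by
    apply integral_nonneg
    intro x
    have h1 : 0 ≤ (f x.1 - f x.2) * (g x.1 - g x.2) := by
      rcases le_total (ρ x.1) (ρ x.2) with h | h
      · exact mul_nonneg_of_nonpos_of_nonpos (sub_nonpos.2 (hf _ _ h)) (sub_nonpos.2 (hg _ _ h))
      · exact mul_nonneg (sub_nonneg.2 (hf _ _ h)) (sub_nonneg.2 (hg _ _ h))
    have h2 := mul_nonneg (mul_nonneg (hp x.1) (hp x.2)) h1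
    simp only [Pi.zero_apply]
    linarith
  have a1 := ip.mul_prod ipfg
  have a2 := ipfg.mul_prod ip
  have a3 := ipf.mul_prod ipg
  have a4 := ipg.mul_prod ipf
  have a12 : Integrable (fun x : Ω × Ω => p x.1 * (p x.2 * f x.2 * g x.2)
    + (p x.1 * f x.1 * g x.1) * p x.2) (μ.prod μ) := a1.add a2
  have a34 : Integrable (fun x : Ω × Ω => (p x.1 * f x.1) * (p x.2 * g x.2)
    + (p x.1 * g x.1) * (p x.2 * f x.2)) (μ.prod μ) := a3.add a4
  rw [integral_sub a12 a34, integral_add a1 a2, integral_add a3 a4,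
    integral_prod_mul p (fun z => p z * f z * g z), integral_prod_mul (fun z => p z * f z * g z) p,
    integral_prod_mul (fun z => p z * f z) (fun z => p z * g z),
    integral_prod_mul (fun z => p z * g z) (fun z => p z * f z)] at h0
  linarith

/-- Increasing differences of `logMean`, jointly in the exponent and the function. -/
lemma logMean_sub_le_sub {m n : ℝ} (hm : 0 ≤ m) (hmn : m ≤ n) {F G H K : Ω → ℝ} (ρ : Ω → ℝ)
    (hF : ∀ u w, ρ u ≤ ρ w → F u ≤ F w) (hd : ∀ u w, ρ u ≤ ρ w → G u - F u ≤ G w - F w)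
    (he : ∀ u w, ρ u ≤ ρ w → H u - F u ≤ H w - F w) (hK : ∀ z, H z + G z - F z ≤ K z)
    (iF : ExpIntegrable μ m F) (iG : ExpIntegrable μ m G) (iH : ExpIntegrable μ n H)
    (iK : ExpIntegrable μ n K)
    (iHGF : Integrable (fun z => Real.exp (n * (H z + G z - F z))) μ)
    (iGF : Integrable (fun z => Real.exp (m * F z + n * (G z - F z))) μ) :
    logMean μ m G - logMean μ m F ≤ logMean μ n K - logMean μ n H := by
  -- Monotonicity in the function reduces the claim to `K = H + G - F`.
  have iHGF' : ExpIntegrable μ n (fun z => H z + G z - F z) := ⟨(iH.1.add iG.1).sub iF.1, iHGF⟩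
  have h1 := logMean_mono (hm.trans hmn) iK iHGF' hK
  refine le_trans ?_ (sub_le_sub_right h1 _)
  rcases hm.eq_or_lt with rfl | hm
  · rcases hmn.eq_or_lt with rfl | hn
    · simp only [logMean, if_true]
      have iHG : Integrable (fun z => H z + G z) μ := iH.1.add iG.1
      rw [integral_sub iHG iF.1, integral_add iH.1 iG.1]
      linarith
    · have e1 : logMean μ 0 G - logMean μ 0 F = ∫ z, (G z - F z) ∂μ := by
        simp only [logMean, if_true]; rw [integral_sub iG.1 iF.1]
      rw [e1, le_sub_iff_add_le]
      apply le_logMean_of_le_integral hn iHGF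
      have iGF' : Integrable (fun z => Real.exp (n * (G z - F z))) μ := by simpa using iGF
      -- For `m = 0` there is no tilt, and Jensen's inequality takes the place of the power mean
      -- inequality.
      have h2 := integral_le_logMean hn.le (f := fun z => G z - F z) ⟨iG.1.sub iF.1, iGF'⟩
      have h3 := integral_mul_integral_le_of_comonotone (μ := μ) (p := fun _ => (1 : ℝ))
        (f := fun z => Real.exp (n * (G z - F z))) (g := fun z => Real.exp (n * H z))
        (fun _ => zero_le_one) ρ
        (fun u w h => Real.exp_le_exp.2 (mul_le_mul_of_nonneg_left (hd u w h) hn.le))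
        (fun u w h => Real.exp_le_exp.2 (mul_le_mul_of_nonneg_left
          (by linarith [he u w h, hF u w h]) hn.le))
        (integrable_const _) (by simpa using iGF') (by simpa using iH.2)
        (by
          refine iHGF.congr (Filter.Eventually.of_forall fun z => ?_)
          simp only [one_mul]; rw [← Real.exp_add]; congr 1; ring)
      have h4 : ∀ z, 1 * Real.exp (n * (G z - F z)) * Real.exp (n * H z)
          = Real.exp (n * (H z + G z - F z)) := by
        intro z; rw [one_mul, ← Real.exp_add]; congr 1; ring
      simp only [h4] at h3
      simp only [one_mul, integral_const, probReal_univ, smul_eq_mul] at h3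
      refine le_trans ?_ h3
      rw [← exp_mul_logMean hn.ne' iGF', ← exp_mul_logMean hn.ne' iH.2, ← Real.exp_add,
        Real.exp_le_exp, mul_add]
      linarith [mul_le_mul_of_nonneg_left h2 hn.le]
  · have hn := hm.trans_le hmn
    set c := logMean μ m G - logMean μ m F with hc
    rw [le_sub_iff_add_le]
    apply le_logMean_of_le_integral hn iHGF
    have e1 : ∀ z, Real.exp (m * F z) * Real.exp (m * (G z - F z)) = Real.exp (m * G z) := by
      intro z; rw [← Real.exp_add]; congr 1; ring
    have e2 : ∀ z, Real.exp (m * F z) * Real.exp (n * (G z - F z))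
        = Real.exp (m * F z + n * (G z - F z)) := by
      intro z; rw [← Real.exp_add]
    have e3 : ∀ z, Real.exp (m * F z) * Real.exp (n * H z - m * F z) = Real.exp (n * H z) := by
      intro z; rw [← Real.exp_add]; congr 1; ring
    have e4 : ∀ z, Real.exp (m * F z + n * (G z - F z)) * Real.exp (n * H z - m * F z)
        = Real.exp (n * (H z + G z - F z)) := by
      intro z; rw [← Real.exp_add]; congr 1; ring
    -- Power mean inequality for `G - F` under the measure tilted by `exp (m * F)`: there `c` is the
    -- log-mean of `G - F` with exponent `m`.
    have h2 := exp_mul_integral_le_of_le (μ := μ) (c := c) hm hmn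
      (p := fun z => Real.exp (m * F z)) (d := fun z => G z - F z) (fun _ => (Real.exp_pos _).le)
      iF.2 (by simpa only [e1] using iG.2) (by simpa only [e2] using iGF)
      (by
        simp only [e1]
        rw [← exp_mul_logMean hm.ne' iF.2, ← exp_mul_logMean hm.ne' iG.2, ← Real.exp_add]
        congr 1; rw [hc]; ring)
    -- The second function is comonotone because `n * H - m * F = n * (H - F) + (n - m) * F`; this
    -- is where `m ≤ n` and the monotonicity of `F` itself enter.
    have h3 := integral_mul_integral_le_of_comonotone (μ := μ) (p := fun z => Real.exp (m * F z))
        (f := fun z => Real.exp (n * (G z - F z))) (g := fun z => Real.exp (n * H z - m * F z))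
        (fun _ => (Real.exp_pos _).le) ρ
        (fun u w h => Real.exp_le_exp.2 (mul_le_mul_of_nonneg_left (hd u w h) hn.le))
        (fun u w h => Real.exp_le_exp.2 (by
          nlinarith [mul_le_mul_of_nonneg_left (he u w h) hn.le,
            mul_le_mul_of_nonneg_left (hF u w h) (sub_nonneg.2 hmn)]))
        iF.2 (by simpa only [e2] using iGF) (by simpa only [e3] using iH.2)
        (by simpa only [e2, e4] using iHGF)
    simp only [e2, e3, e4] at h2 h3
    have hpos : 0 < ∫ z, Real.exp (m * F z) ∂μ := integral_exp_pos iF.2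
    have hposH : 0 < ∫ z, Real.exp (n * H z) ∂μ := integral_exp_pos iH.2
    have h5 := (mul_le_mul_of_nonneg_right h2 hposH.le).trans h3
    rw [mul_add, Real.exp_add, exp_mul_logMean hn.ne' iH.2]
    have h6 : (∫ z, Real.exp (m * F z) ∂μ) * (Real.exp (n * c) * ∫ z, Real.exp (n * H z) ∂μ) ≤
      (∫ z, Real.exp (m * F z) ∂μ) * ∫ z, Real.exp (n * (H z + G z - F z)) ∂μ := by
      linarith
    exact le_of_mul_le_mul_left h6 hpos

end LogMean

/-! ### Function classes: monotone in `|x|`, Lipschitz, exponential growth. -/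

/-- Monotone in the absolute value of the argument; in particular even. -/
def AbsMono (f : ℝ → ℝ) : Prop := ∀ x y, |x| ≤ |y| → f x ≤ f y

/-- Measurable functions of at most exponential growth. -/
structure ExpGrowth (f : ℝ → ℝ) : Prop where
  meas : Measurable f
  bound : ∃ C K : ℝ, 0 ≤ C ∧ 0 ≤ K ∧ ∀ x, |f x| ≤ C * Real.exp (K * |x|)

/-- Lipschitz with some constant. -/
def IsLip (f : ℝ → ℝ) : Prop := ∃ L : ℝ, 0 ≤ L ∧ ∀ x y, |f x - f y| ≤ L * |x - y|

namespace AbsMono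

lemma even {f : ℝ → ℝ} (hf : AbsMono f) (x : ℝ) : f (-x) = f x :=
  le_antisymm (hf _ _ (by simp)) (hf _ _ (by simp))

lemma of_even_of_monotoneOn {f : ℝ → ℝ} (he : ∀ x, f (-x) = f x)
    (hm : MonotoneOn f (Set.Ici 0)) : AbsMono f := by
  have habs : ∀ x, f |x| = f x := by
    intro x
    rcases abs_choice x with h | h <;> rw [h]
    exact he x
  intro x y h
  rw [← habs x, ← habs y]
  exact hm (Set.mem_Ici.2 (abs_nonneg x)) (Set.mem_Ici.2 (abs_nonneg y)) h

lemma add {f g : ℝ → ℝ} (hf : AbsMono f) (hg : AbsMono g) : AbsMono (fun x => f x + g x) :=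
  fun x y h => add_le_add (hf x y h) (hg x y h)

end AbsMono

namespace IsLip

lemma const_mul {f : ℝ → ℝ} (hf : IsLip f) (a : ℝ) : IsLip (fun x => a * f x) := by
  obtain ⟨L, hL, h⟩ := hf
  refine ⟨|a| * L, by positivity, fun x y => ?_⟩
  rw [← mul_sub, abs_mul, mul_assoc]
  exact mul_le_mul_of_nonneg_left (h x y) (abs_nonneg a)

lemma add {f g : ℝ → ℝ} (hf : IsLip f) (hg : IsLip g) : IsLip (fun x => f x + g x) := by
  obtain ⟨L, hL, h⟩ := hf
  obtain ⟨M, hM, h'⟩ := hg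
  refine ⟨L + M, by positivity, fun x y => ?_⟩
  calc |f x + g x - (f y + g y)| = |(f x - f y) + (g x - g y)| := by ring_nf
    _ ≤ |f x - f y| + |g x - g y| := abs_add_le _ _
    _ ≤ (L + M) * |x - y| := by linarith [h x y, h' x y]

lemma sub {f g : ℝ → ℝ} (hf : IsLip f) (hg : IsLip g) : IsLip (fun x => f x - g x) := by
  simpa [sub_eq_add_neg] using hf.add (hg.const_mul (-1))

lemma shift {f : ℝ → ℝ} (hf : IsLip f) (x : ℝ) : IsLip (fun z => f (x + z)) := by
  obtain ⟨L, hL, h⟩ := hf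
  exact ⟨L, hL, fun u w => by simpa using h (x + u) (x + w)⟩

lemma continuous {f : ℝ → ℝ} (hf : IsLip f) : Continuous f := by
  obtain ⟨L, hL, h⟩ := hf
  exact (LipschitzWith.of_dist_le_mul (K := ⟨L, hL⟩) (fun x y => h x y)).continuous

lemma expGrowth_exp {f : ℝ → ℝ} (hf : IsLip f) : ExpGrowth (fun x => Real.exp (f x)) := by
  refine ⟨(Real.continuous_exp.comp hf.continuous).measurable, ?_⟩
  obtain ⟨L, hL, h⟩ := hf
  refine ⟨Real.exp |f 0|, L, (Real.exp_pos _).le, hL, fun x => ?_⟩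
  rw [abs_of_pos (Real.exp_pos _), ← Real.exp_add, Real.exp_le_exp]
  have h1 := h x 0
  rw [sub_zero] at h1
  have h2 := abs_le.1 h1
  linarith [le_abs_self (f 0)]

lemma expGrowth {f : ℝ → ℝ} (hf : IsLip f) : ExpGrowth f := by
  refine ⟨hf.continuous.measurable, ?_⟩
  obtain ⟨L, hL, h⟩ := hf
  refine ⟨|f 0| + L, 1, by positivity, zero_le_one, fun x => ?_⟩
  have h1 := h x 0
  rw [sub_zero] at h1
  have h2 := Real.add_one_le_exp (1 * |x|)
  have h3 : |f x| ≤ |f 0| + L * |x| := by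
    have := abs_sub_abs_le_abs_sub (f x) (f 0); linarith
  have h4 : 1 ≤ Real.exp (1 * |x|) := Real.one_le_exp (by positivity)
  have h5 : |x| ≤ Real.exp (1 * |x|) := by linarith
  nlinarith [mul_le_mul_of_nonneg_left h5 hL, mul_le_mul_of_nonneg_left h4 (abs_nonneg (f 0))]

end IsLip

namespace ExpGrowth

lemma mul {f g : ℝ → ℝ} (hf : ExpGrowth f) (hg : ExpGrowth g) :
    ExpGrowth (fun x => f x * g x) := by
  obtain ⟨C, K, hC, hK, h⟩ := hf.bound
  obtain ⟨D, M, hD, hM, h'⟩ := hg.bound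
  refine ⟨hf.meas.mul hg.meas, C * D, K + M, by positivity, by positivity, fun x => ?_⟩
  rw [abs_mul, add_mul, Real.exp_add]
  calc |f x| * |g x| ≤ (C * Real.exp (K * |x|)) * (D * Real.exp (M * |x|)) :=
        mul_le_mul (h x) (h' x) (abs_nonneg _) (by positivity)
    _ = _ := by ring

lemma shift {f : ℝ → ℝ} (hf : ExpGrowth f) (x : ℝ) : ExpGrowth (fun z => f (x + z)) := by
  obtain ⟨C, K, hC, hK, h⟩ := hf.bound
  refine ⟨hf.meas.comp (measurable_const_add x), C * Real.exp (K * |x|), K, by positivity, hK,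
    fun z => (h _).trans ?_⟩
  rw [mul_assoc, ← Real.exp_add, ← mul_add]
  have := abs_add_le x z
  gcongr

lemma of_bounded {f : ℝ → ℝ} (hf : Measurable f) {C : ℝ} (h : ∀ x, |f x| ≤ C) : ExpGrowth f :=
  ⟨hf, C, 0, (abs_nonneg _).trans (h 0), le_rfl, by simpa using h⟩

lemma const (c : ℝ) : ExpGrowth (fun _ => c) := of_bounded measurable_const fun _ => le_rfl

lemma of_abs_le {f g : ℝ → ℝ} (hg : ExpGrowth g) (hf : Measurable f) (h : ∀ x, |f x| ≤ |g x|) :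
    ExpGrowth f := by
  obtain ⟨C, K, hC, hK, h'⟩ := hg.bound
  exact ⟨hf, C, K, hC, hK, fun x => (h x).trans (h' x)⟩

lemma integrable {f : ℝ → ℝ} (hf : ExpGrowth f) (v : ℝ≥0) : Integrable f (gaussianReal 0 v) := by
  obtain ⟨C, K, hC, hK, h⟩ := hf.bound
  have h1 : Integrable (fun x => C * (Real.exp (K * x) + Real.exp (-K * x))) (gaussianReal 0 v) :=
    ((integrable_exp_mul_gaussianReal K).add (integrable_exp_mul_gaussianReal (-K))).const_mul C
  refine h1.mono' hf.meas.aestronglyMeasurable (Filter.Eventually.of_forall fun x => ?_)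
  rw [Real.norm_eq_abs]
  refine (h x).trans (mul_le_mul_of_nonneg_left ?_ hC)
  rcases abs_choice x with hx | hx <;> rw [hx]
  · linarith [Real.exp_pos (-K * x)]
  · rw [mul_neg, ← neg_mul]; linarith [Real.exp_pos (K * x)]

end ExpGrowth

lemma isLip_mul_left (a : ℝ) : IsLip (fun z => a * z) :=
  ⟨|a|, abs_nonneg a, fun x y => by rw [← mul_sub, abs_mul]⟩

lemma expGrowth_exp_abs (K : ℝ) : ExpGrowth (fun z => Real.exp (K * |z|)) :=
  (IsLip.const_mul ⟨1, zero_le_one, fun x y => by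
    rw [one_mul]; exact abs_abs_sub_abs_le x y⟩ K).expGrowth_exp

lemma expGrowth_cosh (a : ℝ) : ExpGrowth (fun z => Real.cosh (a * z)) := by
  refine (expGrowth_exp_abs |a|).of_abs_le
    (Real.continuous_cosh.comp (continuous_const.mul continuous_id)).measurable fun z => ?_
  rw [abs_of_pos (Real.cosh_pos _), abs_of_pos (Real.exp_pos _), ← abs_mul, ← Real.cosh_abs,
    Real.cosh_eq]
  have : Real.exp (-|a * z|) ≤ Real.exp |a * z| :=
    Real.exp_le_exp.2 (by linarith [abs_nonneg (a * z)])
  linarith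

lemma expGrowth_sinh (a : ℝ) : ExpGrowth (fun z => Real.sinh (a * z)) := by
  refine (expGrowth_cosh a).of_abs_le
    (Real.continuous_sinh.comp (continuous_const.mul continuous_id)).measurable fun z => ?_
  apply sq_le_sq.1
  rw [Real.cosh_sq]; linarith

lemma IsLip.expIntegrable {f : ℝ → ℝ} (hf : IsLip f) (v : ℝ≥0) (a x : ℝ) :
    ExpIntegrable (gaussianReal 0 v) a (fun z => f (x + z)) :=
  ⟨(hf.expGrowth.shift x).integrable v, (((hf.const_mul a).expGrowth_exp).shift x).integrable v⟩

/-! ### Gaussian shifts and monotonicity in `|x|`. -/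

lemma integral_gaussianReal_neg (v : ℝ≥0) (f : ℝ → ℝ) :
    ∫ z, f (-z) ∂(gaussianReal 0 v) = ∫ z, f z ∂(gaussianReal 0 v) := by
  have h := gaussianReal_map_neg (μ := 0) (v := v)
  rw [neg_zero] at h
  conv_rhs => rw [← h]
  exact ((MeasurableEquiv.neg ℝ).measurableEmbedding.integral_map f).symm

/-- Cameron–Martin: completing the square moves the shift from the function to the measure, where it
enters only through an exponential tilt and a constant. -/
lemma gaussianReal_eq_withDensity {v : ℝ≥0} (hv : v ≠ 0) (x : ℝ) :
    gaussianReal x v = (gaussianReal 0 v).withDensity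
      (fun z => ENNReal.ofReal (Real.exp (x / v * z - x ^ 2 / (2 * v)))) := by
  have hv' : (v : ℝ) ≠ 0 := by exact_mod_cast hv
  rw [gaussianReal_of_var_ne_zero _ hv, gaussianReal_of_var_ne_zero _ hv,
    ← withDensity_mul _ (measurable_gaussianPDF 0 v) (by fun_prop)]
  congr 1
  ext z
  simp only [Pi.mul_apply, gaussianPDF]
  rw [← ENNReal.ofReal_mul (gaussianPDFReal_nonneg _ _ _)]
  congr 1
  simp only [gaussianPDFReal]
  rw [mul_assoc _ (Real.exp _), ← Real.exp_add]
  congr 2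
  field_simp
  ring

lemma integral_gaussianReal_shift {v : ℝ≥0} (hv : v ≠ 0) (x : ℝ) (f : ℝ → ℝ) :
    ∫ z, f (x + z) ∂(gaussianReal 0 v)
      = Real.exp (-(x ^ 2 / (2 * v))) * ∫ z, f z * Real.exp (x / v * z) ∂(gaussianReal 0 v) := by
  have h := gaussianReal_map_const_add (μ := 0) (v := v) x
  rw [zero_add, gaussianReal_eq_withDensity hv x] at h
  have h1 : ∫ z, f (x + z) ∂(gaussianReal 0 v) = ∫ z, f z ∂((gaussianReal 0 v).map (x + ·)) :=
    ((MeasurableEquiv.addLeft x).measurableEmbedding.integral_map f).symm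
  rw [h1, h, integral_withDensity_eq_integral_toReal_smul (by fun_prop) (by simp),
    ← integral_const_mul]
  congr 1
  ext z
  rw [ENNReal.toReal_ofReal (Real.exp_pos _).le, smul_eq_mul, sub_eq_add_neg, Real.exp_add]
  ring

lemma integrable_gaussianReal_shift {v : ℝ≥0} (hv : v ≠ 0) (x : ℝ) {f : ℝ → ℝ}
    (hf : Integrable (fun z => f z * Real.exp (x / v * z)) (gaussianReal 0 v)) :
    Integrable (fun z => f (x + z)) (gaussianReal 0 v) := by
  have h := gaussianReal_map_const_add (μ := 0) (v := v) x
  rw [zero_add, gaussianReal_eq_withDensity hv x] at h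
  have h1 : Integrable f ((gaussianReal 0 v).map (x + ·)) := by
    rw [h, integrable_withDensity_iff (by fun_prop) (by simp)]
    refine (hf.const_mul (Real.exp (-(x ^ 2 / (2 * v))))).congr
      (Filter.Eventually.of_forall fun z => ?_)
    simp only
    rw [ENNReal.toReal_ofReal (Real.exp_pos _).le, sub_eq_add_neg, Real.exp_add]
    ring
  exact ((MeasurableEquiv.addLeft x).measurableEmbedding.integrable_map_iff).1 h1

/-- Pairing `z` with `-z` symmetrises the tilt into a positive even weight, so that `|z|` can serve
as rank function in Chebyshev's inequality. -/
lemma integral_gaussianReal_shift_even {v : ℝ≥0} (hv : v ≠ 0) (x : ℝ) {f : ℝ → ℝ}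
    (hf : ExpGrowth f) (he : ∀ z, f (-z) = f z) :
    ∫ z, f (x + z) ∂(gaussianReal 0 v)
      = Real.exp (-(x ^ 2 / (2 * v))) * ∫ z, f z * Real.cosh (x / v * z) ∂(gaussianReal 0 v) := by
  rw [integral_gaussianReal_shift hv]
  congr 1
  have i1 := (hf.mul (isLip_mul_left (x / v)).expGrowth_exp).integrable v
  have i2 := (hf.mul (isLip_mul_left (-(x / v))).expGrowth_exp).integrable v
  have h := integral_gaussianReal_neg v (fun z => f z * Real.exp (x / v * z))
  simp only [he] at h
  have e : ∀ z, f z * Real.cosh (x / v * z) = (1 / 2) *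
      (f z * Real.exp (x / v * z) + f z * Real.exp (-(x / v) * z)) := by
    intro z; rw [Real.cosh_eq, neg_mul]; ring
  simp_rw [e]
  rw [integral_const_mul, integral_add i1 i2]
  have e2 : ∀ z, x / v * -z = -(x / v) * z := fun z => by ring
  simp only [e2] at h
  rw [h]; ring

lemma integral_gaussianReal_shift_odd {v : ℝ≥0} (hv : v ≠ 0) (x : ℝ) {f : ℝ → ℝ}
    (hf : ExpGrowth f) (he : ∀ z, f (-z) = -f z) :
    ∫ z, f (x + z) ∂(gaussianReal 0 v)
      = Real.exp (-(x ^ 2 / (2 * v))) * ∫ z, f z * Real.sinh (x / v * z) ∂(gaussianReal 0 v) := by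
  rw [integral_gaussianReal_shift hv]
  congr 1
  have i1 := (hf.mul (isLip_mul_left (x / v)).expGrowth_exp).integrable v
  have i2 := (hf.mul (isLip_mul_left (-(x / v))).expGrowth_exp).integrable v
  have h := integral_gaussianReal_neg v (fun z => f z * Real.exp (x / v * z))
  simp only [he, neg_mul, integral_neg] at h
  have e : ∀ z, f z * Real.sinh (x / v * z) = (1 / 2) *
      (f z * Real.exp (x / v * z) - f z * Real.exp (-(x / v) * z)) := by
    intro z; rw [Real.sinh_eq, neg_mul]; ring
  simp_rw [e]
  rw [integral_const_mul, integral_sub i1 i2]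
  have e2 : ∀ z, x / v * -z = -(x / v) * z := fun z => by ring
  simp only [e2] at h
  rw [← h]; ring

/-- Total positivity of the kernel `cosh (x * z)` in `|x|` and `|z|`. Each product becomes half a
sum of two hyperbolic cosines, and these are compared term by term using `(|y| - |x|) * (|w| - |u|)
≥ 0`. -/
lemma cosh_mul_cosh_le {x y u w : ℝ} (hxy : |x| ≤ |y|) (huw : |u| ≤ |w|) :
    Real.cosh (y * u) * Real.cosh (x * w) ≤ Real.cosh (y * w) * Real.cosh (x * u) := by
  have hprod : ∀ a b : ℝ, Real.cosh a * Real.cosh b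
      = (Real.cosh (a + b) + Real.cosh (a - b)) / 2 := by
    intro a b; rw [Real.cosh_add, Real.cosh_sub]; ring
  rw [← Real.cosh_abs (y * u), ← Real.cosh_abs (x * w), ← Real.cosh_abs (y * w),
    ← Real.cosh_abs (x * u), abs_mul, abs_mul, abs_mul, abs_mul, hprod, hprod]
  have hx := abs_nonneg x
  have hu := abs_nonneg u
  have h1 : 0 ≤ (|y| - |x|) * (|w| - |u|) := mul_nonneg (sub_nonneg.2 hxy) (sub_nonneg.2 huw)
  have h2 : |y| * |u| ≤ |y| * |w| := mul_le_mul_of_nonneg_left huw (hx.trans hxy)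
  have h3 : |x| * |u| ≤ |x| * |w| := mul_le_mul_of_nonneg_left huw hx
  have h4 : |x| * |w| ≤ |y| * |w| := mul_le_mul_of_nonneg_right hxy (hu.trans huw)
  have h5 : |x| * |u| ≤ |y| * |u| := mul_le_mul_of_nonneg_right hxy hu
  have p1 : 0 ≤ |x| * |u| := mul_nonneg hx hu
  have c1 : Real.cosh (|y| * |u| + |x| * |w|) ≤ Real.cosh (|y| * |w| + |x| * |u|) := by
    rw [Real.cosh_le_cosh, abs_of_nonneg (a := |y| * |u| + |x| * |w|) (by linarith),
      abs_of_nonneg (a := |y| * |w| + |x| * |u|) (by linarith)]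
    nlinarith
  have c2 : Real.cosh (|y| * |u| - |x| * |w|) ≤ Real.cosh (|y| * |w| - |x| * |u|) := by
    rw [Real.cosh_le_cosh, abs_of_nonneg (a := |y| * |w| - |x| * |u|) (by linarith), abs_le]
    constructor <;> linarith
  linarith

lemma absMono_cosh_div_cosh {x y : ℝ} (hxy : |x| ≤ |y|) :
    AbsMono (fun z => Real.cosh (y * z) / Real.cosh (x * z)) := by
  intro u w huw
  simp only
  rw [div_le_div_iff₀ (Real.cosh_pos _) (Real.cosh_pos _)]
  exact cosh_mul_cosh_le hxy huw

/-- The Gaussian average around `x`, weighted by an even function, of a function that increases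
with the absolute value, increases with `|x|`. -/
lemma integral_ratio_mono {v : ℝ≥0} {p f : ℝ → ℝ} (hp : ExpGrowth p) (hp0 : ∀ z, 0 ≤ p z)
    (hpe : ∀ z, p (-z) = p z) (hf : AbsMono f) (hpf : ExpGrowth (fun z => p z * f z))
    {x y : ℝ} (hxy : |x| ≤ |y|) :
    (∫ z, p (x + z) * f (x + z) ∂(gaussianReal 0 v)) * (∫ z, p (y + z) ∂(gaussianReal 0 v)) ≤
      (∫ z, p (x + z) ∂(gaussianReal 0 v)) * ∫ z, p (y + z) * f (y + z) ∂(gaussianReal 0 v) := by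
  rcases eq_or_ne v 0 with rfl | hv
  · simp only [gaussianReal_zero_var, integral_dirac, add_zero]
    have := mul_le_mul_of_nonneg_left (hf x y hxy) (mul_nonneg (hp0 x) (hp0 y))
    linarith
  have hpfe : ∀ z, p (-z) * f (-z) = p z * f z := fun z => by rw [hpe, hf.even]
  rw [integral_gaussianReal_shift_even hv x hpf hpfe, integral_gaussianReal_shift_even hv y hpf hpfe,
    integral_gaussianReal_shift_even hv x hp hpe, integral_gaussianReal_shift_even hv y hp hpe]
  have hxy' : |x / v| ≤ |y / v| := by
    rw [abs_div, abs_div]; gcongr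
  have e1 : ∀ z, p z * Real.cosh (x / v * z) * f z = p z * f z * Real.cosh (x / v * z) :=
    fun z => by ring
  have e2 : ∀ z, p z * Real.cosh (x / v * z) * (Real.cosh (y / v * z) / Real.cosh (x / v * z))
      = p z * Real.cosh (y / v * z) := fun z => by
    have := (Real.cosh_pos (x / v * z)).ne'
    field_simp
  have e3 : ∀ z, p z * f z * Real.cosh (x / v * z) *
      (Real.cosh (y / v * z) / Real.cosh (x / v * z)) = p z * f z * Real.cosh (y / v * z) :=
    fun z => by
      have := (Real.cosh_pos (x / v * z)).ne'
      field_simp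
  -- Passing from `x` to `y` multiplies the weight `p * cosh (x z / v)` by a ratio of hyperbolic
  -- cosines, which increases with `|z|` just as `f` does.
  have key := integral_mul_integral_le_of_comonotone (μ := gaussianReal 0 v)
    (p := fun z => p z * Real.cosh (x / v * z)) (f := f)
    (g := fun z => Real.cosh (y / v * z) / Real.cosh (x / v * z))
    (fun z => mul_nonneg (hp0 z) (Real.cosh_pos _).le) (fun z => |z|) hf
    (absMono_cosh_div_cosh hxy') ((hp.mul (expGrowth_cosh _)).integrable v)
    (by simpa only [e1] using (hpf.mul (expGrowth_cosh (x / v))).integrable v)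
    (by simpa only [e2] using (hp.mul (expGrowth_cosh (y / v))).integrable v)
    (by simpa only [e1, e3] using (hpf.mul (expGrowth_cosh (y / v))).integrable v)
  simp only [e1, e2, e3] at key
  have hpos := mul_nonneg (Real.exp_pos (-(x ^ 2 / (2 * (v : ℝ))))).le
    (Real.exp_pos (-(y ^ 2 / (2 * (v : ℝ))))).le
  have := mul_le_mul_of_nonneg_left key hpos
  linarith

/-! ### One step: regularity and comparison. -/

lemma parisiStep_eq_logMean (a : ℝ) (v : ℝ≥0) (F : ℝ → ℝ) (x : ℝ) :
    parisiStep a v F x = logMean (gaussianReal 0 v) a (fun z => F (x + z)) := rfl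

lemma parisiStep_zero_var (a : ℝ) (F : ℝ → ℝ) : parisiStep a 0 F = F := by
  ext x
  rw [parisiStep]
  split_ifs with h
  · simp
  · simp [h]

lemma parisiStep_even {a : ℝ} {v : ℝ≥0} {F : ℝ → ℝ} (hF : ∀ x, F (-x) = F x) (x : ℝ) :
    parisiStep a v F (-x) = parisiStep a v F x := by
  have h : ∀ z, F (-x + z) = F (x + -z) := fun z => by rw [← hF]; congr 1; ring
  have h1 := integral_gaussianReal_neg v (fun z => F (x + z))
  have h2 := integral_gaussianReal_neg v (fun z => Real.exp (a * F (x + z)))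
  simp only [parisiStep, h, h1, h2]

lemma IsLip.parisiStep {F : ℝ → ℝ} (hF : IsLip F) {a : ℝ} (ha : 0 ≤ a) (v : ℝ≥0) :
    IsLip (parisiStep a v F) := by
  have hF' := hF
  obtain ⟨L, hL, h⟩ := hF
  refine ⟨L, hL, fun x y => ?_⟩
  have key : ∀ x y, _root_.parisiStep a v F x ≤ _root_.parisiStep a v F y + L * |x - y| := by
    intro x y
    refine logMean_le_add ha (hF'.expIntegrable v a y) (hF'.expIntegrable v a x) fun z => ?_
    have := (abs_le.1 (h (x + z) (y + z))).2
    rw [add_sub_add_right_eq_sub] at this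
    linarith
  rw [abs_le]
  have h1 := key x y
  have h2 := key y x
  rw [abs_sub_comm y x] at h2
  constructor <;> linarith

/-- `T_n (F + e) - T_n F` increases with `|x|` if `e` does. -/
lemma absMono_parisiStep_sub {F G : ℝ → ℝ} (hF : IsLip F) (hG : IsLip G) (hFe : ∀ x, F (-x) = F x)
    (hd : AbsMono (fun x => G x - F x)) {a : ℝ} (ha : 0 ≤ a) (v : ℝ≥0) :
    AbsMono (fun x => parisiStep a v G x - parisiStep a v F x) := by
  intro x y hxy
  simp only [parisiStep_eq_logMean]
  rcases ha.eq_or_lt with rfl | ha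
  · have := integral_ratio_mono (v := v) (p := fun _ => 1) (ExpGrowth.const 1)
      (fun _ => zero_le_one) (fun _ => rfl) hd (by simpa using (hG.sub hF).expGrowth) hxy
    simp only [one_mul, integral_const, probReal_univ, smul_eq_mul, mul_one] at this
    simp only [logMean, if_true]
    rw [← integral_sub (hG.expIntegrable v 0 x).1 (hF.expIntegrable v 0 x).1,
      ← integral_sub (hG.expIntegrable v 0 y).1 (hF.expIntegrable v 0 y).1]
    exact this
  -- The quotient of the two exponential integrals is the average of `exp (a * (G - F))` with the
  -- even weight `exp (a * F)`.
  · have e : ∀ z, Real.exp (a * F z) * Real.exp (a * (G z - F z)) = Real.exp (a * G z) := by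
      intro z; rw [← Real.exp_add]; congr 1; ring
    have := integral_ratio_mono (v := v) (p := fun z => Real.exp (a * F z))
      (f := fun z => Real.exp (a * (G z - F z))) (hF.const_mul a).expGrowth_exp
      (fun _ => (Real.exp_pos _).le) (fun z => by simp only [hFe])
      (fun u w h => Real.exp_le_exp.2 (mul_le_mul_of_nonneg_left (hd u w h) ha.le))
      (by simpa only [e] using (hG.const_mul a).expGrowth_exp) hxy
    simp only [e] at this
    rw [← exp_mul_logMean ha.ne' (hF.expIntegrable v a x).2,
      ← exp_mul_logMean ha.ne' (hG.expIntegrable v a x).2,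
      ← exp_mul_logMean ha.ne' (hF.expIntegrable v a y).2,
      ← exp_mul_logMean ha.ne' (hG.expIntegrable v a y).2, ← Real.exp_add, ← Real.exp_add,
      Real.exp_le_exp, ← mul_add, ← mul_add] at this
    linarith [le_of_mul_le_mul_left this ha]

/-- Even convex differentiable Lipschitz functions. -/
structure LipEvenConvex (A : ℝ → ℝ) : Prop where
  even : ∀ x, A (-x) = A x
  convex : ConvexOn ℝ Set.univ A
  diff : Differentiable ℝ A
  lip : IsLip A

lemma abs_deriv_le_of_isLip {A : ℝ → ℝ} {L : ℝ} (hL : 0 ≤ L)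
    (h : ∀ x y, |A x - A y| ≤ L * |x - y|) (x : ℝ) : |deriv A x| ≤ L := by
  have := norm_deriv_le_of_lipschitz (𝕜 := ℝ) (f := A) (x₀ := x) (C := ⟨L, hL⟩)
    (LipschitzWith.of_dist_le_mul (fun x y => h x y))
  exact this

/-- A point of `[0, y]` is a convex combination of `y` and `-y`, where the function takes the same
value. -/
lemma absMono_of_even_convex {A : ℝ → ℝ} (he : ∀ x, A (-x) = A x)
    (hc : ConvexOn ℝ Set.univ A) : AbsMono A := by
  apply AbsMono.of_even_of_monotoneOn he
  intro x hx y hy hxy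
  rcases eq_or_lt_of_le (show (0 : ℝ) ≤ y from hy) with h | h
  · have : x = y := le_antisymm hxy (h ▸ hx)
    rw [this]
  have hx0 : (0 : ℝ) ≤ x := hx
  have h1 : 0 ≤ (y + x) / (2 * y) := by positivity
  have h2 : 0 ≤ (y - x) / (2 * y) := div_nonneg (by linarith) (by positivity)
  have h3 : (y + x) / (2 * y) + (y - x) / (2 * y) = 1 := by field_simp; ring
  have := hc.2 (Set.mem_univ y) (Set.mem_univ (-y)) h1 h2 h3
  rw [he y] at this
  simp only [smul_eq_mul] at this
  have e1 : (y + x) / (2 * y) * y + (y - x) / (2 * y) * -y = x := by field_simp; ring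
  have e2 : (y + x) / (2 * y) * A y + (y - x) / (2 * y) * A y = A y := by field_simp; ring
  rwa [e1, e2] at this

namespace LipEvenConvex

variable {A : ℝ → ℝ}

lemma absMono (hA : LipEvenConvex A) : AbsMono A := absMono_of_even_convex hA.even hA.convex

lemma deriv_odd (hA : LipEvenConvex A) (x : ℝ) : deriv A (-x) = -deriv A x := by
  have h : (fun x => A (-x)) = A := funext hA.even
  have := deriv_comp_neg A x
  rw [h] at this
  linarith

lemma deriv_mono (hA : LipEvenConvex A) : Monotone (deriv A) := by
  have := hA.convex.monotoneOn_deriv (fun x _ => hA.diff x)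
  exact fun x y h => this (Set.mem_univ x) (Set.mem_univ y) h

lemma deriv_nonneg (hA : LipEvenConvex A) {x : ℝ} (hx : 0 ≤ x) : 0 ≤ deriv A x := by
  have h0 : deriv A 0 = 0 := by
    have := hA.deriv_odd 0
    rw [neg_zero] at this; linarith
  rw [← h0]; exact hA.deriv_mono hx

lemma expGrowth_deriv (hA : LipEvenConvex A) : ExpGrowth (deriv A) := by
  obtain ⟨L, hL, h⟩ := hA.lip
  exact ExpGrowth.of_bounded (measurable_deriv A) (abs_deriv_le_of_isLip hL h)

lemma hasDerivAt_integral_exp (hA : LipEvenConvex A) (a : ℝ) (v : ℝ≥0) (x₀ : ℝ) :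
    HasDerivAt (fun x => ∫ z, Real.exp (a * A (x + z)) ∂(gaussianReal 0 v))
      (∫ z, a * deriv A (x₀ + z) * Real.exp (a * A (x₀ + z)) ∂(gaussianReal 0 v)) x₀ := by
  obtain ⟨L, hL, h⟩ := hA.lip
  have hA' := abs_deriv_le_of_isLip hL h
  have hcont := hA.lip.continuous
  refine (hasDerivAt_integral_of_dominated_loc_of_deriv_le (s := Metric.ball x₀ 1)
    (F := fun x z => Real.exp (a * A (x + z)))
    (F' := fun x z => a * deriv A (x + z) * Real.exp (a * A (x + z)))
    (bound := fun z => |a| * L * (Real.exp (|a| * (|A x₀| + L)) * Real.exp ((|a| * L) * |z|)))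
    (Metric.ball_mem_nhds x₀ one_pos) ?_ ?_ ?_ ?_ ?_ ?_).2
  · exact Filter.Eventually.of_forall fun x =>
      (((hA.lip.const_mul a).expGrowth_exp).shift x).meas.aestronglyMeasurable
  · exact (hA.lip.expIntegrable v a x₀).2
  · exact ((((ExpGrowth.const a).mul hA.expGrowth_deriv).mul
      (hA.lip.const_mul a).expGrowth_exp).shift x₀).meas.aestronglyMeasurable
  · refine Filter.Eventually.of_forall fun z x hx => ?_
    rw [Real.norm_eq_abs, abs_mul, abs_mul, abs_of_pos (Real.exp_pos _), ← Real.exp_add]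
    refine mul_le_mul (mul_le_mul_of_nonneg_left (hA' _) (abs_nonneg a)) ?_ (Real.exp_pos _).le
      (by positivity)
    rw [Real.exp_le_exp]
    rw [Metric.mem_ball, Real.dist_eq] at hx
    have h1 := h (x + z) x₀
    have h2 : |x + z - x₀| ≤ 1 + |z| := by
      calc |x + z - x₀| = |(x - x₀) + z| := by ring_nf
        _ ≤ |x - x₀| + |z| := abs_add_le _ _
        _ ≤ 1 + |z| := by linarith
    have h3 : |A (x + z)| ≤ |A x₀| + L * (1 + |z|) := by
      have := abs_sub_abs_le_abs_sub (A (x + z)) (A x₀)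
      have := mul_le_mul_of_nonneg_left h2 hL
      linarith
    calc a * A (x + z) ≤ |a| * |A (x + z)| := by rw [← abs_mul]; exact le_abs_self _
      _ ≤ |a| * (|A x₀| + L * (1 + |z|)) := mul_le_mul_of_nonneg_left h3 (abs_nonneg a)
      _ = _ := by ring
  · exact ((((ExpGrowth.const _).mul (expGrowth_exp_abs (|a| * L))).integrable v).const_mul _)
  · refine Filter.Eventually.of_forall fun z x _ => ?_
    have h1 := (hA.diff (x + z)).hasDerivAt.comp_add_const x z
    have h2 := (h1.const_mul a).exp
    exact h2.congr_deriv (by ring)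

lemma hasDerivAt_integral (hA : LipEvenConvex A) (v : ℝ≥0) (x₀ : ℝ) :
    HasDerivAt (fun x => ∫ z, A (x + z) ∂(gaussianReal 0 v))
      (∫ z, deriv A (x₀ + z) ∂(gaussianReal 0 v)) x₀ := by
  obtain ⟨L, hL, h⟩ := hA.lip
  have hA' := abs_deriv_le_of_isLip hL h
  refine (hasDerivAt_integral_of_dominated_loc_of_deriv_le (s := Metric.ball x₀ 1)
    (F := fun x z => A (x + z)) (F' := fun x z => deriv A (x + z)) (bound := fun _ => L)
    (Metric.ball_mem_nhds x₀ one_pos) ?_ ?_ ?_ ?_ ?_ ?_).2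
  · exact Filter.Eventually.of_forall fun x => (hA.lip.expGrowth.shift x).meas.aestronglyMeasurable
  · exact (hA.lip.expGrowth.shift x₀).integrable v
  · exact (hA.expGrowth_deriv.shift x₀).meas.aestronglyMeasurable
  · exact Filter.Eventually.of_forall fun z x _ => hA' _
  · exact integrable_const _
  · exact Filter.Eventually.of_forall fun z x _ =>
      (hA.diff (x + z)).hasDerivAt.comp_add_const x z

/-- The quotient is the mean of `deriv A` under the Gaussian measure tilted by `exp (a * A)`; in
this form it also covers `a = 0`. -/
lemma hasDerivAt_parisiStep (hA : LipEvenConvex A) (a : ℝ) (v : ℝ≥0) (x : ℝ) :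
    HasDerivAt (parisiStep a v A)
      ((∫ z, Real.exp (a * A (x + z)) * deriv A (x + z) ∂(gaussianReal 0 v)) /
        ∫ z, Real.exp (a * A (x + z)) ∂(gaussianReal 0 v)) x := by
  by_cases ha : a = 0
  · subst ha
    have := hA.hasDerivAt_integral v x
    have e : parisiStep 0 v A = fun x => ∫ z, A (x + z) ∂(gaussianReal 0 v) := by
      ext x; simp [parisiStep]
    rw [e]
    simpa using this
  · have e : parisiStep a v A
        = fun x => (1 / a) * Real.log (∫ z, Real.exp (a * A (x + z)) ∂(gaussianReal 0 v)) := by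
      ext x; simp [parisiStep, ha]
    rw [e]
    have hpos : 0 < ∫ z, Real.exp (a * A (x + z)) ∂(gaussianReal 0 v) :=
      integral_exp_pos (hA.lip.expIntegrable v a x).2
    have := ((hA.hasDerivAt_integral_exp a v x).log hpos.ne').const_mul (1 / a)
    refine this.congr_deriv ?_
    have e2 : ∀ z, a * deriv A (x + z) * Real.exp (a * A (x + z))
      = a * (Real.exp (a * A (x + z)) * deriv A (x + z)) := fun z => by ring
    simp_rw [e2]
    rw [integral_const_mul]
    field_simp

lemma parisiStep (hA : LipEvenConvex A) {a : ℝ} (ha : 0 ≤ a) (v : ℝ≥0) :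
    LipEvenConvex (parisiStep a v A) where
  even := parisiStep_even hA.even
  convex := by
    refine ⟨convex_univ, fun x _ y _ α β hα hβ hαβ => ?_⟩
    have := logMean_le_convex ha (hA.lip.expIntegrable v a x) (hA.lip.expIntegrable v a y)
      (hA.lip.expIntegrable v a (α * x + β * y)) (ε := 0) hα hβ hαβ (fun z => by
        have h := hA.convex.2 (Set.mem_univ (x + z)) (Set.mem_univ (y + z)) hα hβ hαβ
        have e : α • (x + z) + β • (y + z) = α * x + β * y + z := by
          simp only [smul_eq_mul]
          linear_combination z * hαβ
        rw [e] at h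
        simpa using h)
    simpa [parisiStep_eq_logMean] using this
  diff := fun x => (hA.hasDerivAt_parisiStep a v x).differentiableAt
  lip := hA.lip.parisiStep ha v

/-- Both factors are odd, and nonnegative and increasing on the half-line. After the shift is
removed, the derivative of a step is a weighted average of this product. -/
lemma absMono_deriv_mul_tanh (hA : LipEvenConvex A) {x : ℝ} (hx : 0 ≤ x) :
    AbsMono (fun z => deriv A z * (Real.sinh (x * z) / Real.cosh (x * z))) := by
  apply AbsMono.of_even_of_monotoneOn
  · intro z
    rw [hA.deriv_odd, mul_neg, Real.sinh_neg, Real.cosh_neg]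
    ring
  · intro u hu w hw huw
    have hu' : (0 : ℝ) ≤ u := hu
    have hw' : (0 : ℝ) ≤ w := hw
    have h1 : x * u ≤ x * w := mul_le_mul_of_nonneg_left huw hx
    refine mul_le_mul (hA.deriv_mono huw) ?_ ?_ (hA.deriv_nonneg hw')
    · rw [div_le_div_iff₀ (Real.cosh_pos _) (Real.cosh_pos _)]
      have h2 := Real.sinh_sub (x * w) (x * u)
      have h3 : 0 ≤ Real.sinh (x * w - x * u) := Real.sinh_nonneg_iff.2 (by linarith)
      linarith
    · exact div_nonneg (Real.sinh_nonneg_iff.2 (by positivity)) (Real.cosh_pos _).le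

/-- The difference of two steps with ordered parameters increases with `|x|`. -/
lemma absMono_parisiStep_sub_parisiStep (hA : LipEvenConvex A) {m n : ℝ} (hmn : m ≤ n) (v : ℝ≥0) :
    AbsMono (fun x => _root_.parisiStep n v A x - _root_.parisiStep m v A x) := by
  rcases eq_or_ne v 0 with rfl | hv
  · intro x y _
    simp [parisiStep_zero_var]
  apply AbsMono.of_even_of_monotoneOn
  · intro x; rw [parisiStep_even hA.even, parisiStep_even hA.even]
  have hd := fun x => (hA.hasDerivAt_parisiStep n v x).sub (hA.hasDerivAt_parisiStep m v x)
  apply monotoneOn_of_deriv_nonneg (convex_Ici 0)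
  · exact fun x _ => (hd x).continuousAt.continuousWithinAt
  · exact fun x _ => (hd x).differentiableAt.differentiableWithinAt
  intro x hx
  rw [interior_Ici] at hx
  have hx0 : (0 : ℝ) ≤ x := le_of_lt hx
  have hxv : 0 ≤ x / v := by positivity
  change 0 ≤ deriv (_root_.parisiStep n v A - _root_.parisiStep m v A) x
  rw [(hd x).deriv, sub_nonneg]
  have gm := (hA.lip.const_mul m).expGrowth_exp
  have gn := (hA.lip.const_mul n).expGrowth_exp
  rw [div_le_div_iff₀ (integral_exp_pos (hA.lip.expIntegrable v m x).2)
    (integral_exp_pos (hA.lip.expIntegrable v n x).2)]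
  have odd : ∀ a z : ℝ, Real.exp (a * A (-z)) * deriv A (-z)
      = -(Real.exp (a * A z) * deriv A z) := fun a z => by
    rw [hA.even, hA.deriv_odd]; ring
  have evn : ∀ a z : ℝ, Real.exp (a * A (-z)) = Real.exp (a * A z) := fun a z => by rw [hA.even]
  rw [integral_gaussianReal_shift_odd hv x (gm.mul hA.expGrowth_deriv) (odd m),
    integral_gaussianReal_shift_odd hv x (gn.mul hA.expGrowth_deriv) (odd n),
    integral_gaussianReal_shift_even hv x gm (evn m),
    integral_gaussianReal_shift_even hv x gn (evn n)]
  have e1 : ∀ z, Real.exp (m * A z) * Real.cosh (x / v * z) *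
      (deriv A z * (Real.sinh (x / v * z) / Real.cosh (x / v * z)))
      = Real.exp (m * A z) * deriv A z * Real.sinh (x / v * z) := fun z => by
    have := (Real.cosh_pos (x / v * z)).ne'
    field_simp
  have e0 : ∀ z, Real.exp (m * A z) * Real.exp ((n - m) * A z) = Real.exp (n * A z) := fun z => by
    rw [← Real.exp_add]; congr 1; ring
  have e2 : ∀ z, Real.exp (m * A z) * Real.cosh (x / v * z) * Real.exp ((n - m) * A z)
      = Real.exp (n * A z) * Real.cosh (x / v * z) := fun z => by rw [← e0]; ring
  have e3 : ∀ z, Real.exp (m * A z) * deriv A z * Real.sinh (x / v * z) * Real.exp ((n - m) * A z)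
      = Real.exp (n * A z) * deriv A z * Real.sinh (x / v * z) := fun z => by rw [← e0]; ring
  -- Replacing `m` by `n` multiplies the weight by `exp ((n - m) * A)`, which increases with `|z|`.
  -- By Chebyshev it raises the average of `deriv A * tanh`, that is, the derivative of the step.
  have key := integral_mul_integral_le_of_comonotone (μ := gaussianReal 0 v)
    (p := fun z => Real.exp (m * A z) * Real.cosh (x / v * z))
    (f := fun z => deriv A z * (Real.sinh (x / v * z) / Real.cosh (x / v * z)))
    (g := fun z => Real.exp ((n - m) * A z))
    (fun z => mul_nonneg (Real.exp_pos _).le (Real.cosh_pos _).le) (fun z => |z|)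
    (hA.absMono_deriv_mul_tanh hxv)
    (fun u w h => Real.exp_le_exp.2
      (mul_le_mul_of_nonneg_left (hA.absMono u w h) (sub_nonneg.2 hmn)))
    ((gm.mul (expGrowth_cosh _)).integrable v)
    (by simpa only [e1] using
      ((gm.mul hA.expGrowth_deriv).mul (expGrowth_sinh (x / v))).integrable v)
    (by simpa only [e2] using (gn.mul (expGrowth_cosh (x / v))).integrable v)
    (by simpa only [e1, e3] using
      ((gn.mul hA.expGrowth_deriv).mul (expGrowth_sinh (x / v))).integrable v)
  simp only [e1, e2, e3] at key
  have hpos := mul_nonneg (Real.exp_pos (-(x ^ 2 / (2 * (v : ℝ))))).le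
    (Real.exp_pos (-(x ^ 2 / (2 * (v : ℝ))))).le
  have := mul_le_mul_of_nonneg_left key hpos
  linarith

end LipEvenConvex

/-! ### Chains of steps and increasing differences. -/

/-- The composition of the steps with parameters `m i` and variances `v i`; the step of index `0`
is performed last. -/
noncomputable def parisiChain : (r : ℕ) → (Fin r → ℝ) → (Fin r → ℝ≥0) → (ℝ → ℝ) → ℝ → ℝ
  | 0, _, _, F => F
  | r + 1, m, v, F => parisiStep (m 0) (v 0) (parisiChain r (Fin.tail m) (Fin.tail v) F)

lemma parisiChain_succ (r : ℕ) (m : Fin (r + 1) → ℝ) (v : Fin (r + 1) → ℝ≥0) (F : ℝ → ℝ) :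
    parisiChain (r + 1) m v F
      = parisiStep (m 0) (v 0) (parisiChain r (Fin.tail m) (Fin.tail v) F) := rfl

lemma parisiChain_update_zero (r : ℕ) (m : Fin (r + 1) → ℝ) (v : Fin (r + 1) → ℝ≥0) (F : ℝ → ℝ)
    (t : ℝ) : parisiChain (r + 1) (Function.update m 0 t) v F
      = parisiStep t (v 0) (parisiChain r (Fin.tail m) (Fin.tail v) F) := by
  rw [parisiChain_succ, Fin.tail_update_zero, Function.update_self]

lemma parisiChain_update_succ (r : ℕ) (m : Fin (r + 1) → ℝ) (v : Fin (r + 1) → ℝ≥0) (F : ℝ → ℝ)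
    (i : Fin r) (t : ℝ) : parisiChain (r + 1) (Function.update m i.succ t) v F
      = parisiStep (m 0) (v 0)
        (parisiChain r (Function.update (Fin.tail m) i t) (Fin.tail v) F) := by
  rw [parisiChain_succ, Fin.tail_update_succ, Function.update_of_ne (Fin.succ_ne_zero i).symm]

lemma tail_nonneg {r : ℕ} {m : Fin (r + 1) → ℝ} (hm : 0 ≤ m) : 0 ≤ Fin.tail m :=
  fun i => hm i.succ

lemma update_nonneg {r : ℕ} {m : Fin r → ℝ} (hm : 0 ≤ m) {j : Fin r} {t : ℝ} (ht : 0 ≤ t) :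
    0 ≤ Function.update m j t :=
  le_update_iff.2 ⟨ht, fun i _ => hm i⟩

/-- The constant `L` itself is preserved, as required by the short-step expansion, which is uniform
only over functions with a given constant. -/
lemma parisiStep_lipschitz {F : ℝ → ℝ} {L : ℝ} (hL : 0 ≤ L)
    (h : ∀ x y, |F x - F y| ≤ L * |x - y|) {a : ℝ} (ha : 0 ≤ a) (v : ℝ≥0) (x y : ℝ) :
    |parisiStep a v F x - parisiStep a v F y| ≤ L * |x - y| := by
  have hF' : IsLip F := ⟨L, hL, h⟩
  have key : ∀ x y, parisiStep a v F x ≤ parisiStep a v F y + L * |x - y| := by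
    intro x y
    refine logMean_le_add ha (hF'.expIntegrable v a y) (hF'.expIntegrable v a x) fun z => ?_
    have := (abs_le.1 (h (x + z) (y + z))).2
    rw [add_sub_add_right_eq_sub] at this
    linarith
  rw [abs_le]
  have h1 := key x y
  have h2 := key y x
  rw [abs_sub_comm y x] at h2
  constructor <;> linarith

lemma LipEvenConvex.parisiChain {A : ℝ → ℝ} (hA : LipEvenConvex A) :
    ∀ (r : ℕ) (m : Fin r → ℝ) (v : Fin r → ℝ≥0), 0 ≤ m → LipEvenConvex (parisiChain r m v A)
  | 0, _, _, _ => hA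
  | r + 1, m, v, hm =>
    (LipEvenConvex.parisiChain hA r (Fin.tail m) (Fin.tail v) (tail_nonneg hm)).parisiStep (hm 0) _

lemma parisiChain_lipschitz {A : ℝ → ℝ} {L : ℝ} (hL : 0 ≤ L)
    (h : ∀ x y, |A x - A y| ≤ L * |x - y|) :
    ∀ (r : ℕ) (m : Fin r → ℝ) (v : Fin r → ℝ≥0), 0 ≤ m →
      ∀ x y, |parisiChain r m v A x - parisiChain r m v A y| ≤ L * |x - y|
  | 0, _, _, _ => h
  | r + 1, m, v, hm => parisiStep_lipschitz hL
      (parisiChain_lipschitz hL h r (Fin.tail m) (Fin.tail v) (tail_nonneg hm)) (hm 0) _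

/-- Increasing differences for one step, from `logMean_sub_le_sub` with rank `|x + z|`; the
Lipschitz bounds supply every integrability condition. -/
lemma parisiStep_sub_le_sub {m n : ℝ} (hm : 0 ≤ m) (hmn : m ≤ n) (v : ℝ≥0) {F G H K : ℝ → ℝ}
    (lF : IsLip F) (lG : IsLip G) (lH : IsLip H) (lK : IsLip K) (hF : AbsMono F)
    (hd : AbsMono (fun x => G x - F x)) (he : AbsMono (fun x => H x - F x))
    (hK : ∀ x, G x - F x ≤ K x - H x) (x : ℝ) :
    parisiStep m v G x - parisiStep m v F x ≤ parisiStep n v K x - parisiStep n v H x := by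
  refine logMean_sub_le_sub hm hmn (fun z => |x + z|) (fun u w h => hF _ _ h)
    (fun u w h => hd _ _ h) (fun u w h => he _ _ h) (fun z => by linarith [hK (x + z)])
    (lF.expIntegrable v m x) (lG.expIntegrable v m x) (lH.expIntegrable v n x)
    (lK.expIntegrable v n x) ?_ ?_
  · exact ((((lH.add lG).sub lF).const_mul n).expGrowth_exp.shift x).integrable v
  · exact (((lF.const_mul m).add ((lG.sub lF).const_mul n)).expGrowth_exp.shift x).integrable v

section Chain

variable {A : ℝ → ℝ}

/-- The difference of two chains with ordered parameters increases with `|x|`. -/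
lemma absMono_parisiChain_sub (hA : LipEvenConvex A) :
    ∀ (r : ℕ) (a b : Fin r → ℝ) (v : Fin r → ℝ≥0), 0 ≤ a → a ≤ b →
      AbsMono (fun x => parisiChain r b v A x - parisiChain r a v A x)
  | 0, _, _, _, _, _ => fun x y _ => by simp [parisiChain]
  | r + 1, a, b, v, ha, hab => by
    have hab' : Fin.tail a ≤ Fin.tail b := fun i => hab i.succ
    have ih := absMono_parisiChain_sub hA r (Fin.tail a) (Fin.tail b) (Fin.tail v)
      (tail_nonneg ha) hab'
    have la := hA.parisiChain r (Fin.tail a) (Fin.tail v) (tail_nonneg ha)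
    have lb := hA.parisiChain r (Fin.tail b) (Fin.tail v) ((tail_nonneg ha).trans hab')
    -- The difference is split in two: the inner chain changes under the outer parameter `b 0`, then
    -- the outer parameter changes over the inner chain of `a`.
    have h1 := absMono_parisiStep_sub la.lip lb.lip la.even ih ((ha 0).trans (hab 0)) (v 0)
    have h2 := la.absMono_parisiStep_sub_parisiStep (hab 0) (v 0)
    simpa [parisiChain_succ] using h1.add h2

/-- Increasing differences of a chain in its vector of parameters. -/
lemma parisiChain_increasing_differences (hA : LipEvenConvex A) :
    ∀ (r : ℕ) (a b : Fin r → ℝ) (v : Fin r → ℝ≥0), 0 ≤ a → a ≤ b → ∀ (j : Fin r) (s t : ℝ),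
      0 ≤ s → s ≤ t → ∀ x,
      parisiChain r (Function.update a j t) v A x - parisiChain r (Function.update a j s) v A x ≤
        parisiChain r (Function.update b j t) v A x - parisiChain r (Function.update b j s) v A x
  | 0, _, _, _, _, _ => fun j => j.elim0
  | r + 1, a, b, v, ha, hab => by
    intro j s t hs hst x
    have hab' : Fin.tail a ≤ Fin.tail b := fun i => hab i.succ
    have ha' := tail_nonneg ha
    have hb' := ha'.trans hab'
    refine Fin.cases ?_ (fun i => ?_) j
    · simp only [parisiChain_update_zero]
      have la := hA.parisiChain r (Fin.tail a) (Fin.tail v) ha'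
      have lb := hA.parisiChain r (Fin.tail b) (Fin.tail v) hb'
      -- Increasing differences are symmetric in the two changes: here the exponent moves from `s`
      -- to `t` while the inner chain moves from `a` to `b`, hence `H = F` and `K = G`.
      have := parisiStep_sub_le_sub hs hst (v 0) la.lip lb.lip la.lip lb.lip la.absMono
        (absMono_parisiChain_sub hA r _ _ _ ha' hab') (fun u w _ => by simp) (fun _ => le_rfl) x
      linarith
    · simp only [parisiChain_update_succ]
      have ht := hs.trans hst
      have las := hA.parisiChain r _ (Fin.tail v) (update_nonneg (j := i) ha' hs)
      have lat := hA.parisiChain r _ (Fin.tail v) (update_nonneg (j := i) ha' ht)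
      have lbs := hA.parisiChain r _ (Fin.tail v) (update_nonneg (j := i) hb' hs)
      have lbt := hA.parisiChain r _ (Fin.tail v) (update_nonneg (j := i) hb' ht)
      exact parisiStep_sub_le_sub (ha 0) (hab 0) (v 0) las.lip lat.lip lbs.lip lbt.lip las.absMono
        (absMono_parisiChain_sub hA r _ _ _ (update_nonneg ha' hs)
          (update_le_update_iff.2 ⟨hst, fun _ _ => le_rfl⟩))
        (absMono_parisiChain_sub hA r _ _ _ (update_nonneg ha' hs)
          (update_le_update_iff.2 ⟨le_rfl, fun k _ => hab' k⟩))
        (fun z => parisiChain_increasing_differences hA r _ _ _ ha' hab' i s t hs hst z) x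

end Chain

/-- A function on the nonnegative orthant with increasing differences dominates the sum of its
coordinate increments along ordered pairs of points. -/
lemma sum_update_sub_le {r : ℕ} (P : (Fin r → ℝ) → ℝ)
    (hP : ∀ a b, 0 ≤ a → a ≤ b → ∀ (j : Fin r) (s t : ℝ), 0 ≤ s → s ≤ t →
      P (Function.update a j t) - P (Function.update a j s) ≤
        P (Function.update b j t) - P (Function.update b j s))
    {a b : Fin r → ℝ} (ha : 0 ≤ a) (hb : 0 ≤ b) (hab : a ≤ b ∨ b ≤ a) :
    ∑ j, (P (Function.update a j (b j)) - P a) ≤ P b - P a := by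
  -- `s` is the set of coordinates already moved from `a` to `b`. Each further move is compared with
  -- the same move started at `a`.
  have key : ∀ s : Finset (Fin r),
      ∑ j ∈ s, (P (Function.update a j (b j)) - P a) ≤ P (s.piecewise b a) - P a := by
    intro s
    induction s using Finset.induction_on with
    | empty => simp
    | insert j s hj ih =>
      rw [Finset.sum_insert hj, Finset.piecewise_insert]
      have e1 : Function.update (s.piecewise b a) j (a j) = s.piecewise b a := by
        rw [Function.update_eq_self_iff, Finset.piecewise_eq_of_notMem _ _ _ hj]
      have e2 : Function.update a j (a j) = a := Function.update_eq_self j a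
      have h0 : 0 ≤ s.piecewise b a := fun i => by
        by_cases hi : i ∈ s
        · rw [Finset.piecewise_eq_of_mem _ _ _ hi]; exact hb i
        · rw [Finset.piecewise_eq_of_notMem _ _ _ hi]; exact ha i
      have step : P (Function.update a j (b j)) - P a ≤
          P (Function.update (s.piecewise b a) j (b j)) - P (s.piecewise b a) := by
        rcases hab with hab | hab
        · have hle : a ≤ s.piecewise b a := fun i => by
            by_cases hi : i ∈ s
            · rw [Finset.piecewise_eq_of_mem _ _ _ hi]; exact hab i
            · rw [Finset.piecewise_eq_of_notMem _ _ _ hi]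
          have := hP a _ ha hle j (a j) (b j) (ha j) (hab j)
          rwa [e1, e2] at this
        -- When `b ≤ a` the comparison point lies below `a` and the move is downward; the two
        -- reversals cancel.
        · have hle : s.piecewise b a ≤ a := fun i => by
            by_cases hi : i ∈ s
            · rw [Finset.piecewise_eq_of_mem _ _ _ hi]; exact hab i
            · rw [Finset.piecewise_eq_of_notMem _ _ _ hi]
          have := hP _ a h0 hle j (b j) (a j) (hb j) (hab j)
          rw [e1, e2] at this
          linarith
      linarith
  have := key Finset.univ
  rwa [Finset.piecewise_univ] at this

/-! ### Convexity in a single parameter. -/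

/-- Variances add under convolution, and with equal exponents the outer exponential cancels the
inner logarithm. Hence a step can be cut into many short steps. -/
lemma parisiStep_parisiStep {F : ℝ → ℝ} (hF : IsLip F) {a : ℝ} (ha : 0 ≤ a) (u w : ℝ≥0) :
    parisiStep a u (parisiStep a w F) = parisiStep a (u + w) F := by
  have hconv := gaussianReal_conv_gaussianReal (m₁ := 0) (m₂ := 0) (v₁ := u) (v₂ := w)
  rw [add_zero] at hconv
  have hint : ∀ {g : ℝ → ℝ}, ExpGrowth g → ∀ x, ∫ z, g (x + z) ∂(gaussianReal 0 (u + w))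
      = ∫ z, ∫ y, g (x + z + y) ∂(gaussianReal 0 w) ∂(gaussianReal 0 u) := by
    intro g hg x
    rw [← hconv, integral_conv]
    · simp only [add_assoc]
    · rw [hconv]; exact (hg.shift x).integrable _
  ext x
  rcases ha.eq_or_lt with rfl | ha
  · simp only [parisiStep, if_true]
    rw [hint hF.expGrowth]
  · rw [parisiStep_eq_logMean a u, parisiStep_eq_logMean a (u + w)]
    simp only [logMean, if_neg ha.ne']
    rw [hint (hF.const_mul a).expGrowth_exp]
    congr 3
    ext z
    rw [parisiStep_eq_logMean, exp_mul_logMean ha.ne' (hF.expIntegrable w a (x + z)).2]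

lemma parisiChain_const {F : ℝ → ℝ} (hF : IsLip F) {t : ℝ} (ht : 0 ≤ t) (δ : ℝ≥0) :
    ∀ N : ℕ, parisiChain N (fun _ => t) (fun _ => δ) F = parisiStep t (N * δ) F
  | 0 => by simp [parisiChain, parisiStep_zero_var]
  | N + 1 => by
    rw [parisiChain_succ]
    have h1 : Fin.tail (fun _ : Fin (N + 1) => t) = fun _ => t := rfl
    have h2 : Fin.tail (fun _ : Fin (N + 1) => δ) = fun _ => δ := rfl
    rw [h1, h2, parisiChain_const hF ht δ N, parisiStep_parisiStep hF ht]
    congr 1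
    push_cast
    ring

/-- A convexity defect of one step bounds the convexity defect of the chain in that coordinate. -/
lemma parisiChain_update_le_convex {L α β ε a b c : ℝ} (hα : 0 ≤ α) (hβ : 0 ≤ β)
    (hαβ : α + β = 1) (ha : 0 ≤ a) (hb : 0 ≤ b) (hc : 0 ≤ c) {δ : ℝ≥0}
    (hdef : ∀ A : ℝ → ℝ, LipEvenConvex A → (∀ x y, |A x - A y| ≤ L * |x - y|) → ∀ x,
      parisiStep c δ A x ≤ α * parisiStep a δ A x + β * parisiStep b δ A x + ε)
    (hL : 0 ≤ L) {A : ℝ → ℝ} (hA : LipEvenConvex A) (hAL : ∀ x y, |A x - A y| ≤ L * |x - y|) :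
    ∀ (r : ℕ) (m : Fin r → ℝ) (v : Fin r → ℝ≥0), 0 ≤ m → ∀ j, v j = δ → ∀ x,
      parisiChain r (Function.update m j c) v A x ≤
        α * parisiChain r (Function.update m j a) v A x
          + β * parisiChain r (Function.update m j b) v A x + ε
  | 0, _, _, _ => fun j => j.elim0
  | r + 1, m, v, hm => by
    intro j
    have hm' := tail_nonneg hm
    refine Fin.cases ?_ (fun i => ?_) j
    · intro hj x
      simp only [parisiChain_update_zero, hj]
      exact hdef _ (hA.parisiChain r _ _ hm') (parisiChain_lipschitz hL hAL r _ _ hm') x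
    · intro hj x
      simp only [parisiChain_update_succ]
      -- An outer step is convex in its function and commutes with additive constants, so the defect
      -- `ε` passes through unchanged.
      exact logMean_le_convex (hm 0)
        ((hA.parisiChain r _ (Fin.tail v) (update_nonneg hm' ha)).lip.expIntegrable _ _ _)
        ((hA.parisiChain r _ (Fin.tail v) (update_nonneg hm' hb)).lip.expIntegrable _ _ _)
        ((hA.parisiChain r _ (Fin.tail v) (update_nonneg hm' hc)).lip.expIntegrable _ _ _)
        hα hβ hαβ (fun z => parisiChain_update_le_convex hα hβ hαβ ha hb hc hdef hL hA hAL r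
          (Fin.tail m) (Fin.tail v) hm' i hj (x + z))

lemma abs_exp_sub_quadratic_le (y : ℝ) :
    |Real.exp y - (1 + y + y ^ 2 / 2)| ≤ |y| ^ 3 * Real.exp |y| := by
  have := Complex.norm_exp_sub_sum_le_norm_mul_exp (y : ℂ) 3
  simp only [Finset.sum_range_succ, Finset.sum_range_zero, Nat.factorial] at this
  norm_num at this
  have e : Complex.exp y - (1 + y + (y : ℂ) ^ 2 / 2)
      = ((Real.exp y - (1 + y + y ^ 2 / 2) : ℝ) : ℂ) := by push_cast; ring
  rw [e, Complex.norm_real] at this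
  exact this

lemma abs_log_one_add_sub_le {y : ℝ} (hy : |y| ≤ 1 / 2) :
    |Real.log (1 + y) - (y - y ^ 2 / 2)| ≤ 2 * |y| ^ 3 := by
  have h := Real.abs_log_sub_add_sum_range_le (x := -y) (by rw [abs_neg]; linarith) 2
  simp only [Finset.sum_range_succ, Finset.sum_range_zero] at h
  norm_num at h
  have e : -y + y ^ 2 / 2 + Real.log (1 + y) = Real.log (1 + y) - (y - y ^ 2 / 2) := by ring
  rw [e] at h
  refine h.trans ?_
  rw [div_le_iff₀ (by linarith)]
  nlinarith [pow_nonneg (abs_nonneg y) 3]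

/-- Second order expansion of `log (1 + t E + t² Q / 2 + R) / t`, uniform in `t`. -/
lemma abs_log_div_sub_le {K M s t E Q R : ℝ} (hK : 0 ≤ K) (hs : 0 ≤ s) (hs1 : s ≤ 1)
    (ht : 0 < t) (htM : t ≤ M) (hE : |E| ≤ K * s) (hQ : |Q| ≤ K * s ^ 2)
    (hR : |R| ≤ t ^ 3 * (K * s ^ 3)) (hsmall : M * (K * (1 + M + M ^ 2)) * s ≤ 1 / 2) :
    |1 / t * Real.log (1 + (t * E + t ^ 2 * Q / 2 + R)) - (E + t * ((Q - E ^ 2) / 2))| ≤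
      (M ^ 2 * (K + (K * (1 + M + M ^ 2)) ^ 2 + 2 * (K * (1 + M + M ^ 2)) ^ 3)) * s ^ 3 := by
  -- `D` is chosen so that `|y| ≤ t * (D * s)`. Every estimate below keeps a factor `t`, so the
  -- final division by `t` leaves a bound uniform down to `t = 0`.
  set D := K * (1 + M + M ^ 2) with hD
  have hM : 0 ≤ M := ht.le.trans htM
  have hD0 : 0 ≤ D := by positivity
  have hKD : K ≤ D := by rw [hD]; nlinarith [mul_nonneg hK hM, mul_nonneg hK (sq_nonneg M)]
  set y := t * E + t ^ 2 * Q / 2 + R with hy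
  have hw : |y - t * E| ≤ t ^ 2 * (D * s ^ 2) := by
    have e : y - t * E = t ^ 2 * (Q / 2) + R := by rw [hy]; ring
    rw [e]
    have h1 : |t ^ 2 * (Q / 2)| ≤ t ^ 2 * (K * s ^ 2) := by
      rw [abs_mul, abs_of_nonneg (sq_nonneg t), abs_div, abs_two]
      have := abs_nonneg Q
      exact mul_le_mul_of_nonneg_left (by linarith) (sq_nonneg t)
    have h2 : t ^ 3 * (K * s ^ 3) ≤ t ^ 2 * (M * K * s ^ 2) := by
      have : t * s ≤ M := by nlinarith
      calc t ^ 3 * (K * s ^ 3) = (t ^ 2 * K * s ^ 2) * (t * s) := by ring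
        _ ≤ (t ^ 2 * K * s ^ 2) * M := mul_le_mul_of_nonneg_left this (by positivity)
        _ = _ := by ring
    calc |t ^ 2 * (Q / 2) + R| ≤ |t ^ 2 * (Q / 2)| + |R| := abs_add_le _ _
      _ ≤ t ^ 2 * (K * s ^ 2) + t ^ 2 * (M * K * s ^ 2) := by linarith
      _ ≤ t ^ 2 * (D * s ^ 2) := by
        have : 0 ≤ t ^ 2 * (K * M ^ 2 * s ^ 2) := by positivity
        rw [hD]; linarith
  have htE : |t * E| ≤ t * (K * s) := by
    rw [abs_mul, abs_of_pos ht]; exact mul_le_mul_of_nonneg_left hE ht.le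
  have hyb : |y| ≤ t * (D * s) := by
    have e : y = t * E + (t ^ 2 * (Q / 2) + R) := by rw [hy]; ring
    have h1 : |t ^ 2 * (Q / 2)| ≤ t * (M * K * s) := by
      rw [abs_mul, abs_of_nonneg (sq_nonneg t), abs_div, abs_two]
      have h3 : |Q| / 2 ≤ K * s := by
        have := abs_nonneg Q
        have : K * s ^ 2 ≤ K * s := mul_le_mul_of_nonneg_left (by nlinarith) hK
        linarith
      calc t ^ 2 * (|Q| / 2) ≤ t ^ 2 * (K * s) := mul_le_mul_of_nonneg_left h3 (sq_nonneg t)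
        _ = t * (K * s) * t := by ring
        _ ≤ t * (K * s) * M := mul_le_mul_of_nonneg_left htM (by positivity)
        _ = _ := by ring
    have h2 : t ^ 3 * (K * s ^ 3) ≤ t * (M ^ 2 * K * s) := by
      have h4 : t ^ 2 ≤ M ^ 2 := pow_le_pow_left₀ ht.le htM 2
      have h5 : s ^ 2 ≤ 1 := pow_le_one₀ hs hs1
      calc t ^ 3 * (K * s ^ 3) = (t * K * s) * (t ^ 2 * s ^ 2) := by ring
        _ ≤ (t * K * s) * (M ^ 2 * 1) := mul_le_mul_of_nonneg_left
            (mul_le_mul h4 h5 (sq_nonneg s) (sq_nonneg M)) (by positivity)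
        _ = _ := by ring
    rw [e]
    calc |t * E + (t ^ 2 * (Q / 2) + R)| ≤ |t * E| + (|t ^ 2 * (Q / 2)| + |R|) :=
          (abs_add_le _ _).trans (by linarith [abs_add_le (t ^ 2 * (Q / 2)) R])
      _ ≤ t * (K * s) + (t * (M * K * s) + t * (M ^ 2 * K * s)) := by linarith
      _ = t * (D * s) := by rw [hD]; ring
  have hy2 : |y| ≤ 1 / 2 := by
    refine hyb.trans (le_trans ?_ hsmall)
    calc t * (D * s) = (D * s) * t := by ring
      _ ≤ (D * s) * M := mul_le_mul_of_nonneg_left htM (by positivity)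
      _ = _ := by ring
  have hlog := abs_log_one_add_sub_le hy2
  have hy3 : |y| ^ 3 ≤ t * (M ^ 2 * D ^ 3 * s ^ 3) := by
    have h4 : t ^ 2 ≤ M ^ 2 := pow_le_pow_left₀ ht.le htM 2
    calc |y| ^ 3 ≤ (t * (D * s)) ^ 3 := pow_le_pow_left₀ (abs_nonneg y) hyb 3
      _ = (t * D ^ 3 * s ^ 3) * t ^ 2 := by ring
      _ ≤ (t * D ^ 3 * s ^ 3) * M ^ 2 := mul_le_mul_of_nonneg_left h4 (by positivity)
      _ = _ := by ring
  have hprod : |(y - t * E) * (y + t * E)| ≤ 2 * t * (M ^ 2 * D ^ 2 * s ^ 3) := by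
    have h6 : |y + t * E| ≤ 2 * t * (D * s) := by
      have : t * (K * s) ≤ t * (D * s) := by gcongr
      linarith [abs_add_le y (t * E)]
    rw [abs_mul]
    have h4 : t ^ 2 ≤ M ^ 2 := pow_le_pow_left₀ ht.le htM 2
    calc |y - t * E| * |y + t * E| ≤ (t ^ 2 * (D * s ^ 2)) * (2 * t * (D * s)) :=
          mul_le_mul hw h6 (abs_nonneg _) (by positivity)
      _ = (2 * t * D ^ 2 * s ^ 3) * t ^ 2 := by ring
      _ ≤ (2 * t * D ^ 2 * s ^ 3) * M ^ 2 := mul_le_mul_of_nonneg_left h4 (by positivity)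
      _ = _ := by ring
  have hR' : |R| ≤ t * (M ^ 2 * K * s ^ 3) := by
    have h4 : t ^ 2 ≤ M ^ 2 := pow_le_pow_left₀ ht.le htM 2
    calc |R| ≤ t ^ 3 * (K * s ^ 3) := hR
      _ = (t * K * s ^ 3) * t ^ 2 := by ring
      _ ≤ (t * K * s ^ 3) * M ^ 2 := mul_le_mul_of_nonneg_left h4 (by positivity)
      _ = _ := by ring
  -- This uses `y ^ 2 = (t * E) ^ 2 + (y - t * E) * (y + t * E)`.
  have e : 1 / t * Real.log (1 + y) - (E + t * ((Q - E ^ 2) / 2)) =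
      1 / t * ((Real.log (1 + y) - (y - y ^ 2 / 2)) + (R - (y - t * E) * (y + t * E) / 2)) := by
    rw [hy]; field_simp; ring
  rw [e, abs_mul, abs_of_pos (by positivity), one_div, inv_mul_le_iff₀ ht]
  have h7 : |(y - t * E) * (y + t * E) / 2| ≤ t * (M ^ 2 * D ^ 2 * s ^ 3) := by
    rw [abs_div, abs_two]; linarith
  calc _ ≤ |Real.log (1 + y) - (y - y ^ 2 / 2)| + (|R| + |(y - t * E) * (y + t * E) / 2|) :=
        (abs_add_le _ _).trans (add_le_add le_rfl (abs_sub _ _))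
    _ ≤ 2 * (t * (M ^ 2 * D ^ 3 * s ^ 3))
        + (t * (M ^ 2 * K * s ^ 3) + t * (M ^ 2 * D ^ 2 * s ^ 3)) := by linarith
    _ = _ := by ring

lemma integral_gaussianReal_eq_standard (v : ℝ≥0) {f : ℝ → ℝ} (hf : Measurable f) :
    ∫ z, f z ∂(gaussianReal 0 v) = ∫ z, f (√(v : ℝ) * z) ∂(gaussianReal 0 1) := by
  have h := gaussianReal_map_const_mul (μ := 0) (v := 1) (√(v : ℝ))
  have hv : (NNReal.mk (√(v : ℝ) ^ 2) (sq_nonneg _)) * 1 = v := by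
    rw [mul_one]; ext; simp
  rw [mul_zero, hv] at h
  rw [← h, integral_map (by fun_prop) hf.aestronglyMeasurable]

lemma abs_integral_le_of_abs_le {v : ℝ≥0} {f g : ℝ → ℝ} (hg : Integrable g (gaussianReal 0 v))
    (h : ∀ z, |f z| ≤ g z) : |∫ z, f z ∂(gaussianReal 0 v)| ≤ ∫ z, g z ∂(gaussianReal 0 v) :=
  norm_integral_le_of_norm_le (f := f) hg (Filter.Eventually.of_forall fun z => h z)

lemma expGrowth_abs_pow_mul_exp (n : ℕ) (c : ℝ) :
    ExpGrowth (fun z => |z| ^ n * Real.exp (c * |z|)) := by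
  refine ExpGrowth.mul ?_ (expGrowth_exp_abs c)
  have h1 : ExpGrowth (fun z => |z|) := IsLip.expGrowth ⟨1, zero_le_one, fun x y => by
    rw [one_mul]; exact abs_abs_sub_abs_le x y⟩
  induction n with
  | zero => simpa using ExpGrowth.const 1
  | succ k ih => simpa only [pow_succ] using ih.mul h1

/-- Gaussian absolute moments with exponential weight scale like powers of the deviation. -/
lemma exists_integral_abs_pow_mul_exp_le (c : ℝ) (hc : 0 ≤ c) :
    ∃ κ : ℝ, 0 ≤ κ ∧ ∀ v : ℝ≥0, √(v : ℝ) ≤ 1 → ∀ n ∈ ({1, 2, 3} : Finset ℕ),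
      ∫ z, |z| ^ n * Real.exp (c * |z|) ∂(gaussianReal 0 v) ≤ κ * √(v : ℝ) ^ n := by
  set I : ℕ → ℝ := fun n => ∫ z, |z| ^ n * Real.exp (c * |z|) ∂(gaussianReal 0 1)
  have hI : ∀ n, 0 ≤ I n := fun n => integral_nonneg fun z => by positivity
  refine ⟨∑ n ∈ ({1, 2, 3} : Finset ℕ), I n, Finset.sum_nonneg fun n _ => hI n,
    fun v hv n hn => ?_⟩
  have hs : 0 ≤ √(v : ℝ) := Real.sqrt_nonneg _
  rw [integral_gaussianReal_eq_standard v (expGrowth_abs_pow_mul_exp n c).meas]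
  calc ∫ z, |√(v : ℝ) * z| ^ n * Real.exp (c * |√(v : ℝ) * z|) ∂(gaussianReal 0 1)
      ≤ ∫ z, √(v : ℝ) ^ n * (|z| ^ n * Real.exp (c * |z|)) ∂(gaussianReal 0 1) := by
        refine integral_mono_of_nonneg (Filter.Eventually.of_forall fun z => by positivity)
          (((expGrowth_abs_pow_mul_exp n c).integrable 1).const_mul _)
          (Filter.Eventually.of_forall fun z => ?_)
        simp only
        rw [abs_mul, abs_of_nonneg hs, mul_pow, mul_assoc]
        have : √(v : ℝ) * |z| ≤ |z| := mul_le_of_le_one_left (abs_nonneg z) hv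
        gcongr
    _ = I n * √(v : ℝ) ^ n := by rw [integral_const_mul, mul_comm]
    _ ≤ _ := mul_le_mul_of_nonneg_right
        (Finset.single_le_sum (f := I) (fun n _ => hI n) hn) (by positivity)

/-- For small variance, a step is affine in its parameter up to an error of order `v ^ (3 / 2)`,
uniformly over functions with a given Lipschitz constant. -/
lemma exists_parisiStep_expansion (L M : ℝ) (hL : 0 ≤ L) (hM : 0 ≤ M) :
    ∃ C s₀ : ℝ, 0 < s₀ ∧ ∀ (v : ℝ≥0), √(v : ℝ) ≤ s₀ → ∀ A : ℝ → ℝ,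
      (∀ x y, |A x - A y| ≤ L * |x - y|) → ∀ x, ∃ p q : ℝ, ∀ t, 0 ≤ t → t ≤ M →
        |parisiStep t v A x - (p + t * q)| ≤ C * √(v : ℝ) ^ 3 := by
  obtain ⟨κ, hκ, hmom⟩ := exists_integral_abs_pow_mul_exp_le (M * L) (by positivity)
  -- The factor `(1 + L) ^ 3` dominates `L ^ n` for the three moments `n = 1, 2, 3` that occur.
  set K := (1 + L) ^ 3 * κ with hK
  have hK0 : 0 ≤ K := by positivity
  set D := K * (1 + M + M ^ 2) with hD
  have hD0 : 0 ≤ D := by positivity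
  refine ⟨M ^ 2 * (K + D ^ 2 + 2 * D ^ 3), min 1 (1 / (2 * (M * D + 1))), by positivity,
    fun v hv A hA x => ?_⟩
  set s := √(v : ℝ) with hs
  have hs0 : 0 ≤ s := Real.sqrt_nonneg _
  have hs1 : s ≤ 1 := hv.trans (min_le_left _ _)
  have hsmall : M * D * s ≤ 1 / 2 := by
    have h1 : s ≤ 1 / (2 * (M * D + 1)) := hv.trans (min_le_right _ _)
    rw [le_div_iff₀ (by positivity)] at h1
    linarith
  have lA : IsLip A := ⟨L, hL, hA⟩
  set X : ℝ → ℝ := fun z => A (x + z) - A x with hX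
  have lX : IsLip X := by simpa using (lA.shift x).sub ⟨0, le_rfl, fun _ _ => by simp⟩
  have hXL : ∀ z, |X z| ≤ L * |z| := fun z => by simpa using hA (x + z) x
  have gX : ExpGrowth X := lX.expGrowth
  have gX2 : ExpGrowth (fun z => X z ^ 2) := by simpa only [sq] using gX.mul gX
  have hLpow : ∀ n : ℕ, n ≤ 3 → L ^ n ≤ (1 + L) ^ 3 := fun n hn =>
    (pow_le_pow_left₀ hL (by linarith) n).trans (pow_le_pow_right₀ (by linarith) hn)
  have hmoment : ∀ n ∈ ({1, 2, 3} : Finset ℕ),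
      ∫ z, L ^ n * (|z| ^ n * Real.exp (M * L * |z|)) ∂(gaussianReal 0 v) ≤ K * s ^ n := by
    intro n hn
    rw [integral_const_mul]
    have h3 : n ≤ 3 := by fin_cases hn <;> norm_num
    have h4 : 0 ≤ ∫ z, |z| ^ n * Real.exp (M * L * |z|) ∂(gaussianReal 0 v) :=
      integral_nonneg fun z => by positivity
    calc _ ≤ (1 + L) ^ 3 * (κ * s ^ n) :=
          mul_le_mul (hLpow n h3) (hmom v hs1 n hn) h4 (by positivity)
      _ = _ := by rw [hK]; ring
  have hint : ∀ n : ℕ, Integrable (fun z => L ^ n * (|z| ^ n * Real.exp (M * L * |z|)))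
      (gaussianReal 0 v) := fun n => ((expGrowth_abs_pow_mul_exp n _).integrable v).const_mul _
  have hXpow : ∀ n : ℕ, ∀ z, |X z| ^ n ≤ L ^ n * (|z| ^ n * Real.exp (M * L * |z|)) := by
    intro n z
    have h1 : 1 ≤ Real.exp (M * L * |z|) := Real.one_le_exp (by positivity)
    calc |X z| ^ n ≤ (L * |z|) ^ n := pow_le_pow_left₀ (abs_nonneg _) (hXL z) n
      _ = L ^ n * (|z| ^ n * 1) := by rw [mul_pow, mul_one]
      _ ≤ _ := by gcongr
  set E := ∫ z, X z ∂(gaussianReal 0 v) with hE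
  set Q := ∫ z, X z ^ 2 ∂(gaussianReal 0 v) with hQ
  have hEb : |E| ≤ K * s := by
    have h1 := abs_integral_le_of_abs_le (f := X) (hint 1) (fun z => by simpa using hXpow 1 z)
    have h2 := hmoment 1 (by simp)
    rw [pow_one] at h2
    exact h1.trans (by simpa using h2)
  have hQb : |Q| ≤ K * s ^ 2 :=
    (abs_integral_le_of_abs_le (f := fun z => X z ^ 2) (hint 2)
      (fun z => by rw [abs_pow]; exact hXpow 2 z)).trans (hmoment 2 (by simp))
  -- Intercept and slope are the mean of `A (x + z)` and half its variance, the first two cumulants.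
  refine ⟨A x + E, (Q - E ^ 2) / 2, fun t ht htM => ?_⟩
  have hAX : ∀ z, A (x + z) = A x + X z := fun z => by rw [hX]; ring
  rcases ht.eq_or_lt with rfl | ht
  · have : parisiStep 0 v A x = A x + E := by
      simp only [parisiStep, if_true, hAX]
      rw [integral_add (integrable_const _) (gX.integrable v)]
      simp [hE]
    rw [this]
    simp only [zero_mul, add_zero, sub_self, abs_zero]
    positivity
  · have gexp : ExpGrowth (fun z => Real.exp (t * X z)) := (lX.const_mul t).expGrowth_exp
    set R := ∫ z, (Real.exp (t * X z) - (1 + t * X z + (t * X z) ^ 2 / 2)) ∂(gaussianReal 0 v)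
      with hR
    have hRb : |R| ≤ t ^ 3 * (K * s ^ 3) := by
      have h1 := abs_integral_le_of_abs_le
        (f := fun z => Real.exp (t * X z) - (1 + t * X z + (t * X z) ^ 2 / 2))
        ((hint 3).const_mul (t ^ 3)) (fun z => by
          refine (abs_exp_sub_quadratic_le _).trans ?_
          rw [abs_mul, abs_of_pos ht, mul_pow, mul_assoc]
          refine mul_le_mul_of_nonneg_left ?_ (by positivity)
          rw [← mul_assoc, ← mul_pow]
          refine mul_le_mul (pow_le_pow_left₀ (abs_nonneg _) (hXL z) 3) ?_ (Real.exp_pos _).le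
            (by positivity)
          rw [Real.exp_le_exp, mul_assoc]
          exact mul_le_mul htM (hXL z) (abs_nonneg _) hM)
      rw [integral_const_mul] at h1
      exact h1.trans (mul_le_mul_of_nonneg_left (hmoment 3 (by simp)) (by positivity))
    have i1 : Integrable (fun z => t * X z) (gaussianReal 0 v) := (gX.integrable v).const_mul t
    have i2 : Integrable (fun z => (t * X z) ^ 2 / 2) (gaussianReal 0 v) := by
      simpa only [mul_pow] using ((gX2.integrable v).const_mul (t ^ 2)).div_const 2
    have i01 : Integrable (fun z => 1 + t * X z) (gaussianReal 0 v) := (integrable_const 1).add i1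
    have i012 : Integrable (fun z => 1 + t * X z + (t * X z) ^ 2 / 2) (gaussianReal 0 v) :=
      i01.add i2
    have hU : ∫ z, Real.exp (t * X z) ∂(gaussianReal 0 v)
        = 1 + (t * E + t ^ 2 * Q / 2 + R) := by
      rw [hR, integral_sub (gexp.integrable v) i012, integral_add i01 i2,
        integral_add (integrable_const 1) i1, integral_const_mul]
      simp only [mul_pow]
      rw [integral_div, integral_const_mul]
      simp only [integral_const, probReal_univ, smul_eq_mul, mul_one, ← hE, ← hQ]
      ring
    have hstep : parisiStep t v A x = A x
        + 1 / t * Real.log (1 + (t * E + t ^ 2 * Q / 2 + R)) := by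
      rw [← hU]
      simp only [parisiStep, if_neg ht.ne', hAX, mul_add, Real.exp_add]
      rw [integral_const_mul, Real.log_mul (Real.exp_pos _).ne'
        (integral_exp_pos (gexp.integrable v)).ne', Real.log_exp, mul_add]
      congr 1
      field_simp
    have := abs_log_div_sub_le hK0 hs0 hs1 ht htM hEb hQb hRb hsmall
    rw [hstep]
    convert this using 2
    ring

/-- Convexity of a step in its parameter. -/
lemma LipEvenConvex.parisiStep_le_convex {A : ℝ → ℝ} (hA : LipEvenConvex A) (v : ℝ≥0)
    {α β a b : ℝ} (hα : 0 ≤ α) (hβ : 0 ≤ β) (hαβ : α + β = 1) (ha : 0 ≤ a) (hb : 0 ≤ b) (x : ℝ) :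
    _root_.parisiStep (α * a + β * b) v A x ≤
      α * _root_.parisiStep a v A x + β * _root_.parisiStep b v A x := by
  obtain ⟨L, hL, hAL⟩ := hA.lip
  set c := α * a + β * b with hc
  have hc0 : 0 ≤ c := by positivity
  obtain ⟨C, s₀, hs₀, hexp⟩ := exists_parisiStep_expansion L (max a b) hL (ha.trans (le_max_left _ _))
  have hcM : c ≤ max a b := by
    have h1 := mul_le_mul_of_nonneg_left (le_max_left a b) hα
    have h2 := mul_le_mul_of_nonneg_left (le_max_right a b) hβ
    have h3 : (α + β) * max a b = max a b := by rw [hαβ, one_mul]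
    linarith
  -- The affine part has no convexity defect. The error at `c` and the averaged errors at `a` and
  -- `b` each contribute one `C`.
  have hdef : ∀ δ : ℝ≥0, √(δ : ℝ) ≤ s₀ → ∀ B : ℝ → ℝ, LipEvenConvex B →
      (∀ x y, |B x - B y| ≤ L * |x - y|) → ∀ x, _root_.parisiStep c δ B x ≤
        α * _root_.parisiStep a δ B x + β * _root_.parisiStep b δ B x + 2 * C * √(δ : ℝ) ^ 3 := by
    intro δ hδ B _ hBL y
    obtain ⟨p, q, hpq⟩ := hexp δ hδ B hBL y
    have h1 := (abs_le.1 (hpq a ha (le_max_left _ _))).1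
    have h2 := (abs_le.1 (hpq b hb (le_max_right _ _))).1
    have h3 := (abs_le.1 (hpq c hc0 hcM)).2
    have h1' := mul_le_mul_of_nonneg_left h1 hα
    have h2' := mul_le_mul_of_nonneg_left h2 hβ
    have e1 : α * (p + a * q) + β * (p + b * q) = p + c * q := by
      rw [hc]; linear_combination p * hαβ
    have e2 : α * -(C * √(δ : ℝ) ^ 3) + β * -(C * √(δ : ℝ) ^ 3) = -(C * √(δ : ℝ) ^ 3) := by
      linear_combination -(C * √(δ : ℝ) ^ 3) * hαβ
    linarith
  have hN : ∀ N : ℕ, 0 < N → √((v / N : ℝ≥0) : ℝ) ≤ s₀ →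
      _root_.parisiStep c v A x ≤ α * _root_.parisiStep a v A x + β * _root_.parisiStep b v A x
        + 2 * C * v * √((v / N : ℝ≥0) : ℝ) := by
    intro N hN0 hNs
    set δ : ℝ≥0 := v / N with hδ
    have hNδ : (N : ℝ≥0) * δ = v := by
      rw [hδ]; field_simp
    set P : (Fin N → ℝ) → ℝ := fun m => _root_.parisiChain N m (fun _ => δ) A x with hP
    have hPc : ∀ t, 0 ≤ t → P (fun _ => t) = _root_.parisiStep t v A x := fun t ht => by
      simp only [hP]; rw [parisiChain_const hA.lip ht, hNδ]
    have hid : ∀ a b : Fin N → ℝ, 0 ≤ a → a ≤ b → ∀ (j : Fin N) (s t : ℝ), 0 ≤ s → s ≤ t →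
        P (Function.update a j t) - P (Function.update a j s) ≤
          P (Function.update b j t) - P (Function.update b j s) :=
      fun a b ha hab j s t hs hst =>
        parisiChain_increasing_differences hA N a b _ ha hab j s t hs hst x
    have hcmp : ∀ t, (fun _ : Fin N => c) ≤ (fun _ => t) ∨ (fun _ : Fin N => t) ≤ fun _ => c :=
      fun t => (le_total c t).imp (fun h _ => h) (fun h _ => h)
    -- Constant vectors are always ordered, so increasing differences compare moving all `N`
    -- parameters from `c` with moving them one at a time.
    have Ha := sum_update_sub_le P hid (a := fun _ => c) (b := fun _ => a) (fun _ => hc0)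
      (fun _ => ha) (hcmp a)
    have Hb := sum_update_sub_le P hid (a := fun _ => c) (b := fun _ => b) (fun _ => hc0)
      (fun _ => hb) (hcmp b)
    have hj : ∀ j, -(2 * C * √(δ : ℝ) ^ 3) ≤
        α * (P (Function.update (fun _ => c) j a) - P fun _ => c)
          + β * (P (Function.update (fun _ => c) j b) - P fun _ => c) := by
      intro j
      have := parisiChain_update_le_convex hα hβ hαβ ha hb hc0 (hdef δ hNs) hL hA hAL N
        (fun _ => c) (fun _ => δ) (fun _ => hc0) j rfl x
      have e : Function.update (fun _ : Fin N => c) j c = fun _ => c := Function.update_eq_self j _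
      rw [e] at this
      have e3 : α * P (fun _ => c) + β * P (fun _ => c) = P (fun _ => c) := by
        linear_combination (P fun _ => c) * hαβ
      change P (fun _ => c) ≤ α * P _ + β * P _ + _ at this
      linarith
    have hsum := Finset.sum_le_sum (fun j (_ : j ∈ Finset.univ) => hj j)
    rw [Finset.sum_add_distrib, ← Finset.mul_sum, ← Finset.mul_sum, Finset.sum_const,
      Finset.card_univ, Fintype.card_fin, nsmul_eq_mul] at hsum
    have Ha' := mul_le_mul_of_nonneg_left Ha hα
    have Hb' := mul_le_mul_of_nonneg_left Hb hβ
    rw [hPc c hc0, hPc a ha] at Ha'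
    rw [hPc c hc0, hPc b hb] at Hb'
    -- Since `N * δ = v`, the `N` defects of order `δ ^ (3 / 2)` add up to order `v * √δ`, which
    -- tends to `0`.
    have e4 : (N : ℝ) * -(2 * C * √(δ : ℝ) ^ 3) = -(2 * C * v * √(δ : ℝ)) := by
      have h5 : √(δ : ℝ) ^ 2 = δ := Real.sq_sqrt δ.2
      have h6 : (N : ℝ) * δ = v := by exact_mod_cast hNδ
      rw [← h6]
      calc _ = -(2 * C * (N * √(δ : ℝ) ^ 2) * √(δ : ℝ)) := by ring
        _ = _ := by rw [h5]
    rw [e4, hPc c hc0] at hsum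
    have e5 : α * _root_.parisiStep c v A x + β * _root_.parisiStep c v A x
        = _root_.parisiStep c v A x := by linear_combination _root_.parisiStep c v A x * hαβ
    linarith
  have hlim : Filter.Tendsto (fun N : ℕ => √((v / N : ℝ≥0) : ℝ)) Filter.atTop (nhds 0) := by
    have h1 : Filter.Tendsto (fun N : ℕ => (v : ℝ) / N) Filter.atTop (nhds 0) :=
      tendsto_const_div_atTop_nhds_zero_nat _
    have h2 := (Real.continuous_sqrt.tendsto 0).comp h1
    rw [Real.sqrt_zero] at h2
    exact h2.congr fun N => by simp
  have hlim2 := (hlim.const_mul (2 * C * v)).const_add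
    (α * _root_.parisiStep a v A x + β * _root_.parisiStep b v A x)
  rw [mul_zero, add_zero] at hlim2
  refine ge_of_tendsto hlim2 ?_
  filter_upwards [Filter.eventually_gt_atTop 0, hlim.eventually (ge_mem_nhds hs₀)] with N h1 h2
  exact hN N h1 h2

/-- Convexity of a chain in each of its parameters. -/
lemma LipEvenConvex.parisiChain_update_le {A : ℝ → ℝ} (hA : LipEvenConvex A)
    {α β a b : ℝ} (hα : 0 ≤ α) (hβ : 0 ≤ β) (hαβ : α + β = 1) (ha : 0 ≤ a) (hb : 0 ≤ b)
    (r : ℕ) (m : Fin r → ℝ) (v : Fin r → ℝ≥0) (hm : 0 ≤ m) (j : Fin r) (x : ℝ) :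
    _root_.parisiChain r (Function.update m j (α * a + β * b)) v A x ≤
      α * _root_.parisiChain r (Function.update m j a) v A x
        + β * _root_.parisiChain r (Function.update m j b) v A x := by
  obtain ⟨L, hL, hAL⟩ := hA.lip
  have := parisiChain_update_le_convex (L := L) (ε := 0) hα hβ hαβ ha hb
    (c := α * a + β * b) (by positivity) (δ := v j)
    (fun B hB _ y => by simpa using hB.parisiStep_le_convex (v j) hα hβ hαβ ha hb y) hL hA hAL
    r m v hm j rfl x
  simpa using this

/-! ### Lipschitz approximation and moderate growth. -/

/-- A smooth even convex function is the increasing limit of Lipschitz ones of the same kind. -/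
lemma exists_lipEvenConvex_approx {Φ : ℝ → ℝ} (hΦ : IsSmoothConvexSymm Φ) :
    ∃ A : ℕ → ℝ → ℝ, (∀ n, LipEvenConvex (A n)) ∧ (∀ n x, 0 ≤ A n x) ∧ (∀ n x, A n x ≤ Φ x) ∧
      ∀ x, Filter.Tendsto (fun n => A n x) Filter.atTop (nhds (Φ x)) := by
  have hd : Differentiable ℝ Φ := hΦ.smooth.differentiable (by simp)
  have hcont : Continuous (deriv Φ) := hΦ.smooth.continuous_deriv (by simp)
  have hmono : Monotone (deriv Φ) := fun x y h =>
    hΦ.convex.monotoneOn_deriv (fun x _ => hd x) (Set.mem_univ x) (Set.mem_univ y) h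
  have hodd : ∀ x, deriv Φ (-x) = -deriv Φ x := fun x => by
    have h : (fun x => Φ (-x)) = Φ := funext hΦ.symm
    have := deriv_comp_neg Φ x
    rw [h] at this
    linarith
  -- The derivative is clamped outside `[-n, n]`; it stays odd and monotone, and its primitive from
  -- `0` is even, convex and Lipschitz.
  set g : ℕ → ℝ → ℝ := fun n t => deriv Φ (max (-(n : ℝ)) (min n t)) with hg
  have gcont : ∀ n, Continuous (g n) := fun n =>
    hcont.comp (continuous_const.max (continuous_const.min continuous_id))
  have gmono : ∀ n, Monotone (g n) := fun n x y h =>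
    hmono (max_le_max le_rfl (min_le_min le_rfl h))
  have godd : ∀ n t, g n (-t) = -g n t := fun n t => by
    simp only [hg]
    rw [← hodd]
    congr 1
    have hn : (0 : ℝ) ≤ n := Nat.cast_nonneg n
    rcases le_total (n : ℝ) t with h | h <;> rcases le_total (-(n : ℝ)) t with h' | h' <;>
      simp only [min_def, max_def] <;> split_ifs <;> linarith
  set A : ℕ → ℝ → ℝ := fun n x => ∫ t in (0 : ℝ)..x, g n t with hA
  have hder : ∀ n x, HasDerivAt (A n) (g n x) x := fun n x =>
    intervalIntegral.integral_hasDerivAt_right ((gcont n).intervalIntegrable _ _)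
      ((gcont n).stronglyMeasurableAtFilter _ _) (gcont n).continuousAt
  have Aderiv : ∀ n, deriv (A n) = g n := fun n => funext fun x => (hder n x).deriv
  have Aeven : ∀ n x, A n (-x) = A n x := fun n x => by
    simp only [hA]
    have h1 := intervalIntegral.integral_comp_neg (a := 0) (b := x) (g n)
    rw [neg_zero] at h1
    rw [intervalIntegral.integral_symm, ← h1]
    simp only [godd]
    rw [intervalIntegral.integral_neg, neg_neg]
  have Adiff : ∀ n, Differentiable ℝ (A n) := fun n x => (hder n x).differentiableAt
  have Aconv : ∀ n, ConvexOn ℝ Set.univ (A n) := fun n =>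
    Monotone.convexOn_univ_of_deriv (Adiff n) (by rw [Aderiv]; exact gmono n)
  have Alip : ∀ n, IsLip (A n) := fun n => by
    have hb : ∀ x, |g n x| ≤ deriv Φ n := fun x => by
      have hn : (0 : ℝ) ≤ n := Nat.cast_nonneg n
      have h1 : g n x ≤ deriv Φ n := hmono (max_le (by linarith) (min_le_left _ _))
      have h2 : deriv Φ (-n) ≤ g n x := hmono (le_max_left _ _)
      rw [hodd] at h2
      exact abs_le.2 ⟨h2, h1⟩
    refine ⟨deriv Φ n, (abs_nonneg _).trans (hb 0), fun x y => ?_⟩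
    have := Convex.norm_image_sub_le_of_norm_hasDerivWithin_le (s := Set.univ) (f := A n)
      (f' := g n) (C := deriv Φ n) (fun x _ => (hder n x).hasDerivWithinAt)
      (fun x _ => hb x) convex_univ (Set.mem_univ y) (Set.mem_univ x)
    exact this
  have Alec : ∀ n, LipEvenConvex (A n) := fun n => ⟨Aeven n, Aconv n, Adiff n, Alip n⟩
  have hΦint : ∀ x, Φ x = ∫ t in (0 : ℝ)..x, deriv Φ t := fun x => by
    rw [intervalIntegral.integral_deriv_eq_sub (fun t _ => hd t) (hcont.intervalIntegrable _ _),
      hΦ.zero, sub_zero]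
  have Ale : ∀ n x, A n x ≤ Φ x := by
    have hpos : ∀ n x, 0 ≤ x → A n x ≤ Φ x := fun n x hx => by
      rw [hΦint x]
      apply intervalIntegral.integral_mono_on hx ((gcont n).intervalIntegrable _ _)
        (hcont.intervalIntegrable _ _)
      intro t ht
      have hn : (0 : ℝ) ≤ n := Nat.cast_nonneg n
      exact hmono (max_le (by linarith [ht.1]) (min_le_right _ _))
    intro n x
    rcases le_total 0 x with h | h
    · exact hpos n x h
    · rw [← Aeven, ← hΦ.symm]; exact hpos n (-x) (by linarith)
  refine ⟨A, Alec, fun n x => ?_, Ale, fun x => ?_⟩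
  · have h0 : A n 0 = 0 := by simp [hA]
    rw [← h0]
    exact (Alec n).absMono 0 x (by simp)
  -- The sequence is constant once `n ≥ |x|`.
  · apply tendsto_const_nhds.congr'
    obtain ⟨N, hN⟩ := exists_nat_ge |x|
    filter_upwards [Filter.eventually_ge_atTop N] with n hn
    rw [hΦint x]
    apply intervalIntegral.integral_congr
    intro t ht
    have hn' : |x| ≤ n := hN.trans (by exact_mod_cast hn)
    have htx : |t| ≤ n := by
      have := Set.abs_sub_left_of_mem_uIcc ht
      simp only [sub_zero] at this
      exact this.trans hn'
    have := abs_le.1 htx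
    simp only [hg]
    rw [min_eq_right this.2, max_eq_right this.1]

/-- The Gaussian average of an extended nonnegative function. -/
noncomputable def gaussAvg (v : ℝ≥0) (g : ℝ → ENNReal) (x : ℝ) : ENNReal :=
  ∫⁻ z, g (x + z) ∂(gaussianReal 0 v)

lemma measurable_gaussAvg (v : ℝ≥0) {g : ℝ → ENNReal} (hg : Measurable g) :
    Measurable (gaussAvg v g) :=
  Measurable.lintegral_prod_right (f := fun x z => g (x + z))
    (hg.comp (measurable_fst.add measurable_snd))

lemma gaussAvg_gaussAvg (u w : ℝ≥0) {g : ℝ → ENNReal} (hg : Measurable g) :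
    gaussAvg u (gaussAvg w g) = gaussAvg (u + w) g := by
  have hconv := gaussianReal_conv_gaussianReal (m₁ := 0) (m₂ := 0) (v₁ := u) (v₂ := w)
  rw [add_zero] at hconv
  ext x
  simp only [gaussAvg]
  rw [← hconv, Measure.lintegral_conv (f := fun z => g (x + z)) (by fun_prop)]
  simp only [add_assoc]

/-- Jensen's inequality by averaging the midpoint inequality over `z` and `-z`; no integrability is
needed. -/
lemma le_gaussAvg (v : ℝ≥0) {G : ℝ → ℝ} (hG : ConvexOn ℝ Set.univ G) (hm : Measurable G)
    (hG0 : ∀ x, 0 ≤ G x) (x : ℝ) :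
    ENNReal.ofReal (G x) ≤ gaussAvg v (fun y => ENNReal.ofReal (G y)) x := by
  have hneg : ∫⁻ z, ENNReal.ofReal (G (x + -z)) ∂(gaussianReal 0 v)
      = ∫⁻ z, ENNReal.ofReal (G (x + z)) ∂(gaussianReal 0 v) := by
    have h := gaussianReal_map_neg (μ := 0) (v := v)
    rw [neg_zero] at h
    conv_rhs => rw [← h]
    rw [lintegral_map (by fun_prop) (by fun_prop)]
  have key : ∀ z, 2 * ENNReal.ofReal (G x)
      ≤ ENNReal.ofReal (G (x + z)) + ENNReal.ofReal (G (x + -z)) := fun z => by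
    have := hG.2 (Set.mem_univ (x + z)) (Set.mem_univ (x + -z)) (by norm_num : (0:ℝ) ≤ 1 / 2)
      (by norm_num : (0:ℝ) ≤ 1 / 2) (by norm_num)
    simp only [smul_eq_mul] at this
    have e : 1 / 2 * (x + z) + 1 / 2 * (x + -z) = x := by ring
    rw [e] at this
    rw [← ENNReal.ofReal_add (hG0 _) (hG0 _), ← ENNReal.ofReal_ofNat 2,
      ← ENNReal.ofReal_mul (by norm_num)]
    exact ENNReal.ofReal_le_ofReal (by linarith)
  have h2 : 2 * ENNReal.ofReal (G x) ≤ 2 * gaussAvg v (fun y => ENNReal.ofReal (G y)) x := by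
    calc 2 * ENNReal.ofReal (G x) = ∫⁻ _, 2 * ENNReal.ofReal (G x) ∂(gaussianReal 0 v) := by simp
      _ ≤ ∫⁻ z, (ENNReal.ofReal (G (x + z)) + ENNReal.ofReal (G (x + -z))) ∂(gaussianReal 0 v) :=
        lintegral_mono key
      _ = 2 * gaussAvg v (fun y => ENNReal.ofReal (G y)) x := by
        rw [lintegral_add_left (by fun_prop), hneg, two_mul, gaussAvg]
  exact (ENNReal.mul_le_mul_iff_right (by norm_num) (by norm_num)).1 h2

lemma measurable_parisiStep (a : ℝ) (v : ℝ≥0) {F : ℝ → ℝ} (hF : Measurable F) :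
    Measurable (parisiStep a v F) := by
  have key : ∀ {f : ℝ → ℝ}, Measurable f →
      Measurable fun x => ∫ z, f (x + z) ∂(gaussianReal 0 v) := fun {f} hf =>
    (StronglyMeasurable.integral_prod_right (f := fun x z => f (x + z))
      (hf.comp (measurable_fst.add measurable_snd)).stronglyMeasurable).measurable
  by_cases ha : a = 0
  · subst ha
    have e : parisiStep 0 v F = fun x => ∫ z, F (x + z) ∂(gaussianReal 0 v) := by
      ext x; simp [parisiStep]
    rw [e]; exact key hF
  · have e : parisiStep a v F
        = fun x => (1 / a) * Real.log (∫ z, Real.exp (a * F (x + z)) ∂(gaussianReal 0 v)) := by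
      ext x; simp [parisiStep, ha]
    rw [e]
    exact (Real.measurable_log.comp (key (f := fun y => Real.exp (a * F y))
      (hF.const_mul a).exp)).const_mul _

lemma measurable_parisiChain {F : ℝ → ℝ} (hF : Measurable F) :
    ∀ (r : ℕ) (m : Fin r → ℝ) (v : Fin r → ℝ≥0), Measurable (parisiChain r m v F)
  | 0, _, _ => hF
  | r + 1, _, _ => measurable_parisiStep _ _ (measurable_parisiChain hF r _ _)

/-- Nonnegative measurable functions `F` for which `exp (c * F)` is dominated by the Gaussian
average of `g` with variance `s`. -/
structure ExpDominated (g : ℝ → ENNReal) (c : ℝ) (s : ℝ≥0) (F : ℝ → ℝ) : Prop where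
  meas : Measurable F
  nonneg : ∀ x, 0 ≤ F x
  le : ∀ x, ENNReal.ofReal (Real.exp (c * F x)) ≤ gaussAvg s g x

namespace ExpDominated

variable {g : ℝ → ENNReal} {c : ℝ} {s v : ℝ≥0} {F : ℝ → ℝ}

lemma lintegral_le (hg : Measurable g) (hF : ExpDominated g c s F) (x : ℝ) :
    ∫⁻ z, ENNReal.ofReal (Real.exp (c * F (x + z))) ∂(gaussianReal 0 v)
      ≤ gaussAvg (v + s) g x := by
  rw [← gaussAvg_gaussAvg v s hg]
  exact lintegral_mono fun z => hF.le (x + z)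

lemma integrable_exp (hg : Measurable g) (hfin : ∀ x, gaussAvg (v + s) g x < ⊤)
    (hF : ExpDominated g c s F) (x : ℝ) :
    Integrable (fun z => Real.exp (c * F (x + z))) (gaussianReal 0 v) := by
  have hm := hF.meas
  refine ⟨Measurable.aestronglyMeasurable (by fun_prop), ?_⟩
  rw [hasFiniteIntegral_iff_ofReal (Filter.Eventually.of_forall fun z => (Real.exp_pos _).le)]
  exact (hF.lintegral_le hg x).trans_lt (hfin x)

lemma le_exp (hc : 1 < c) (hF : ExpDominated g c s F) (x : ℝ) : F x ≤ Real.exp (c * F x) := by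
  have h1 := Real.add_one_le_exp (c * F x)
  have h2 := hF.nonneg x
  nlinarith

/-- As `F` is nonnegative, negative exponents are allowed too; two-sided derivatives at `0` depend
on this. -/
lemma expIntegrable (hc : 1 < c) (hg : Measurable g) (hfin : ∀ x, gaussAvg (v + s) g x < ⊤)
    (hF : ExpDominated g c s F) {a : ℝ} (ha : a ≤ c) (x : ℝ) :
    ExpIntegrable (gaussianReal 0 v) a (fun z => F (x + z)) := by
  have hm := hF.meas
  have hi := hF.integrable_exp hg hfin x
  constructor
  · refine hi.mono' (Measurable.aestronglyMeasurable (by fun_prop)) (Filter.Eventually.of_forall fun z => ?_)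
    rw [Real.norm_eq_abs, abs_of_nonneg (hF.nonneg _)]
    exact hF.le_exp hc _
  · refine hi.mono' (Measurable.aestronglyMeasurable (by fun_prop)) (Filter.Eventually.of_forall fun z => ?_)
    rw [Real.norm_eq_abs, abs_of_pos (Real.exp_pos _), Real.exp_le_exp]
    exact mul_le_mul_of_nonneg_right ha (hF.nonneg _)

/-- The power mean inequality raises the exponent from `a` to `c`, and `exp (c * ·)` of a step with
exponent `c` is exactly a Gaussian average. The variance budget grows by `v`. -/
lemma parisiStep (hc : 1 < c) (hg : Measurable g) (hfin : ∀ x, gaussAvg (v + s) g x < ⊤)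
    (hF : ExpDominated g c s F) {a : ℝ} (ha0 : 0 ≤ a) (ha : a ≤ c) :
    ExpDominated g c (v + s) (parisiStep a v F) where
  meas := measurable_parisiStep a v hF.meas
  nonneg := fun x => by
    have := logMean_mono (μ := gaussianReal 0 v) ha0 (hF.expIntegrable hc hg hfin ha x)
      (h := fun _ => 0) ⟨integrable_const _, by simp⟩ (fun z => hF.nonneg _)
    rwa [logMean_const] at this
  le := fun x => by
    have hcc := hF.expIntegrable hc hg hfin le_rfl x
    have h1 := logMean_mono_exponent ha0 ha (hF.expIntegrable hc hg hfin ha x) hcc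
    have hc0 : 0 < c := by linarith
    refine le_trans (ENNReal.ofReal_le_ofReal (Real.exp_le_exp.2
      (mul_le_mul_of_nonneg_left h1 hc0.le))) ?_
    rw [exp_mul_logMean hc0.ne' hcc.2, ofReal_integral_eq_lintegral_ofReal hcc.2
      (Filter.Eventually.of_forall fun z => (Real.exp_pos _).le)]
    exact hF.lintegral_le hg x

end ExpDominated

/-- Domination of a whole chain, when all Gaussian averages up to the total variance are finite. -/
lemma ExpDominated.parisiChain {g : ℝ → ENNReal} {c : ℝ} {F : ℝ → ℝ} (hc : 1 < c)
    (hg : Measurable g) (hF : ExpDominated g c 0 F) :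
    ∀ (r : ℕ) (m : Fin r → ℝ) (v : Fin r → ℝ≥0),
      (∀ w ≤ ∑ i, v i, ∀ x, gaussAvg w g x < ⊤) → (∀ i, 0 ≤ m i) → (∀ i, m i ≤ c) →
      ExpDominated g c (∑ i, v i) (parisiChain r m v F)
  | 0, _, _, _, _, _ => by simpa [_root_.parisiChain] using hF
  | r + 1, m, v, hfin, hm0, hmc => by
    rw [Fin.sum_univ_succ] at hfin ⊢
    have ih := ExpDominated.parisiChain hc hg hF r (Fin.tail m) (Fin.tail v)
      (fun w hw => hfin w (hw.trans (le_add_of_nonneg_left zero_le)))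
      (fun i => hm0 i.succ) (fun i => hmc i.succ)
    exact ih.parisiStep hc hg (hfin _ le_rfl) (hm0 0) (hmc 0)

lemma tendsto_parisiStep {a : ℝ} {v : ℝ≥0} {F : ℝ → ℝ} {Fn : ℕ → ℝ → ℝ}
    (hmeas : ∀ n, Measurable (Fn n)) (h0 : ∀ n x, 0 ≤ Fn n x) (hle : ∀ n x, Fn n x ≤ F x)
    (hlim : ∀ x, Filter.Tendsto (fun n => Fn n x) Filter.atTop (nhds (F x))) (ha : 0 ≤ a) {x : ℝ}
    (hint : ExpIntegrable (gaussianReal 0 v) a (fun z => F (x + z))) :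
    Filter.Tendsto (fun n => parisiStep a v (Fn n) x) Filter.atTop (nhds (parisiStep a v F x)) := by
  by_cases ha0 : a = 0
  · subst ha0
    simp only [parisiStep, if_true]
    refine tendsto_integral_of_dominated_convergence (fun z => F (x + z))
      (fun n => ((hmeas n).comp (measurable_const_add x)).aestronglyMeasurable) hint.1
      (fun n => Filter.Eventually.of_forall fun z => ?_)
      (Filter.Eventually.of_forall fun z => hlim (x + z))
    rw [Real.norm_eq_abs, abs_of_nonneg (h0 n _)]
    exact hle n _
  · simp only [parisiStep, if_neg ha0]
    refine ((Real.continuousAt_log (integral_exp_pos hint.2).ne').tendsto.comp ?_).const_mul _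
    refine tendsto_integral_of_dominated_convergence (fun z => Real.exp (a * F (x + z)))
      (fun n => ?_) hint.2 (fun n => Filter.Eventually.of_forall fun z => ?_)
      (Filter.Eventually.of_forall fun z =>
        (Real.continuous_exp.tendsto _).comp ((hlim (x + z)).const_mul a))
    · have := hmeas n
      exact Measurable.aestronglyMeasurable (by fun_prop)
    · rw [Real.norm_eq_abs, abs_of_pos (Real.exp_pos _), Real.exp_le_exp]
      exact mul_le_mul_of_nonneg_left (hle n _) ha

/-- Continuity of chains along the Lipschitz approximation. -/
lemma tendsto_parisiChain {g : ℝ → ENNReal} {c : ℝ} {Φ : ℝ → ℝ} (hc : 1 < c)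
    (hg : Measurable g) (hΦ : ExpDominated g c 0 Φ) {A : ℕ → ℝ → ℝ}
    (hA : ∀ n, LipEvenConvex (A n)) (hA0 : ∀ n x, 0 ≤ A n x) (hAΦ : ∀ n x, A n x ≤ Φ x)
    (hlim : ∀ x, Filter.Tendsto (fun n => A n x) Filter.atTop (nhds (Φ x))) :
    ∀ (r : ℕ) (m : Fin r → ℝ) (v : Fin r → ℝ≥0),
      (∀ w ≤ ∑ i, v i, ∀ x, gaussAvg w g x < ⊤) → (∀ i, 0 ≤ m i) → (∀ i, m i ≤ c) →
      (∀ n x, 0 ≤ parisiChain r m v (A n) x) ∧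
      (∀ n x, parisiChain r m v (A n) x ≤ parisiChain r m v Φ x) ∧
      ∀ x, Filter.Tendsto (fun n => parisiChain r m v (A n) x) Filter.atTop
        (nhds (parisiChain r m v Φ x))
  | 0, _, _, _, _, _ => ⟨hA0, hAΦ, hlim⟩
  | r + 1, m, v, hfin, hm0, hmc => by
    rw [Fin.sum_univ_succ] at hfin
    have hfin' : ∀ w ≤ ∑ i, Fin.tail v i, ∀ x, gaussAvg w g x < ⊤ :=
      fun w hw => hfin w (hw.trans (le_add_of_nonneg_left zero_le))
    obtain ⟨ih0, ihle, ihlim⟩ := tendsto_parisiChain hc hg hΦ hA hA0 hAΦ hlim r (Fin.tail m)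
      (Fin.tail v) hfin' (fun i => hm0 i.succ) (fun i => hmc i.succ)
    have dom := hΦ.parisiChain hc hg r (Fin.tail m) (Fin.tail v) hfin'
      (fun i => hm0 i.succ) (fun i => hmc i.succ)
    have hint := fun x => dom.expIntegrable hc hg (hfin _ le_rfl) (hmc 0) x
    have lip := fun n => ((hA n).parisiChain r (Fin.tail m) (Fin.tail v)
      (fun i => hm0 i.succ)).lip
    refine ⟨fun n x => ?_, fun n x => ?_, fun x => ?_⟩
    · have := logMean_mono (hm0 0) ((lip n).expIntegrable (v 0) (m 0) x)
        (h := fun _ => 0) ⟨integrable_const _, by simp⟩ (fun z => ih0 n (x + z))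
      rwa [logMean_const] at this
    · exact logMean_mono (hm0 0) (hint x) ((lip n).expIntegrable (v 0) (m 0) x)
        (fun z => ihle n (x + z))
    · exact tendsto_parisiStep (fun n => (lip n).continuous.measurable) ih0 ihle ihlim (hm0 0)
        (hint x)

/-! ### Differentiability in the parameters. -/

/-- Differentiation under the integral sign from a Lipschitz bound at the base point only. -/
lemma differentiableAt_integral_of_lip {Ω : Type*} [MeasurableSpace Ω] {μ : Measure Ω}
    {f : ℝ → Ω → ℝ} {t₀ : ℝ} {s : Set ℝ} (hs : s ∈ nhds t₀) {bound : Ω → ℝ}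
    (hmeas : ∀ t, Measurable (f t)) (hint : Integrable (f t₀) μ)
    (hlip : ∀ z, ∀ t ∈ s, |f t z - f t₀ z| ≤ bound z * |t - t₀|) (hb : Integrable bound μ)
    (hd : ∀ z, DifferentiableAt ℝ (fun t => f t z) t₀) :
    DifferentiableAt ℝ (fun t => ∫ z, f t z ∂μ) t₀ := by
  set d : Ω → ℝ := fun z => deriv (fun t => f t z) t₀ with hdef
  have hdm : Measurable d := by
    -- The derivative is measurable as a limit of difference quotients along `1 / (n + 1)`.
    refine measurable_of_tendsto_metrizable (f := fun (n : ℕ) z =>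
      ((1 : ℝ) / (n + 1))⁻¹ • (f (t₀ + 1 / (n + 1)) z - f t₀ z)) (fun n => ?_) ?_
    · simp only [smul_eq_mul]
      exact ((hmeas _).sub (hmeas _)).const_mul _
    · rw [tendsto_pi_nhds]
      intro z
      have h1 := (hasDerivAt_iff_tendsto_slope_zero.1 (hd z).hasDerivAt)
      have h2 : Filter.Tendsto (fun n : ℕ => (1 : ℝ) / (n + 1)) Filter.atTop
          (nhdsWithin 0 {0}ᶜ) := by
        refine tendsto_nhdsWithin_iff.2 ⟨tendsto_one_div_add_atTop_nhds_zero_nat,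
          Filter.Eventually.of_forall fun n => ?_⟩
        have : (0 : ℝ) < 1 / (n + 1) := by positivity
        exact this.ne'
      exact h1.comp h2
  have := hasFDerivAt_integral_of_dominated_loc_of_lip' (𝕜 := ℝ) (F := f) (x₀ := t₀) (s := s)
    (μ := μ) (bound := bound)
    (F' := fun z => ContinuousLinearMap.toSpanSingleton ℝ (d z)) hs
    (fun t _ => (hmeas t).aestronglyMeasurable) hint ?_
    (Filter.Eventually.of_forall fun z t ht => hlip z t ht) hb
    (Filter.Eventually.of_forall fun z => (hd z).hasDerivAt.hasFDerivAt)
  · exact this.2.differentiableAt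
  · have hc : Continuous (fun y : ℝ => ContinuousLinearMap.toSpanSingleton ℝ y) :=
      (ContinuousLinearMap.toSpanSingletonCLE (𝕜 := ℝ) (E := ℝ)).continuous
    exact (hc.measurable.comp hdm).aestronglyMeasurable

/-- Differentiation under the integral sign for nonnegative families that are convex and monotone
in the parameter. -/
lemma differentiableAt_integral_of_convex {Ω : Type*} [MeasurableSpace Ω] {μ : Measure Ω}
    {f : ℝ → Ω → ℝ} {t₀ c : ℝ} (ht0 : 0 < t₀) (htc : t₀ < c) (hmeas : ∀ t, Measurable (f t))
    (hnn : ∀ t ∈ Set.Icc 0 c, ∀ z, 0 ≤ f t z) (hconv : ∀ z, ConvexOn ℝ (Set.Icc 0 c) (f · z))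
    (hmono : ∀ z, MonotoneOn (f · z) (Set.Icc 0 c)) (hint : Integrable (f t₀) μ)
    (hintc : Integrable (f c) μ)
    (hd : ∀ z, DifferentiableAt ℝ (fun t => f t z) t₀) :
    DifferentiableAt ℝ (fun t => ∫ z, f t z ∂μ) t₀ := by
  set ρ := (c - t₀) / 2 with hρ
  have hρ0 : 0 < ρ := by rw [hρ]; linarith
  refine differentiableAt_integral_of_lip (s := Set.Ioo 0 (t₀ + ρ))
    (bound := fun z => ρ⁻¹ * f c z) (Ioo_mem_nhds ht0 (by linarith)) hmeas hint ?_
    (hintc.const_mul _) hd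
  have hc0 : 0 ≤ c := by linarith
  -- By convexity a secant slope left of `t₀ + ρ` is at most the slope from `b` to `c`. That run has
  -- length at least `ρ`, and nonnegativity leaves only `f c`.
  have key : ∀ z a b, 0 ≤ a → a ≤ b → b ≤ t₀ + ρ → f b z - f a z ≤ ρ⁻¹ * f c z * (b - a) := by
    intro z a b ha hab hb
    have hbc : b < c := by rw [hρ] at hb; linarith
    have ham : a ∈ Set.Icc 0 c := ⟨ha, by linarith⟩
    rcases hab.eq_or_lt with rfl | hab
    · simp
    have h1 := (hconv z).slope_mono_adjacent ham ⟨hc0, le_rfl⟩ hab hbc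
    have hba : 0 < b - a := by linarith
    have hcb : ρ ≤ c - b := by rw [hρ] at hb ⊢; linarith
    have h2 : (f c z - f b z) / (c - b) ≤ ρ⁻¹ * f c z := by
      rw [inv_mul_eq_div]
      have hfb := hnn b ⟨by linarith, hbc.le⟩ z
      have hfc := hnn c ⟨hc0, le_rfl⟩ z
      calc (f c z - f b z) / (c - b) ≤ f c z / (c - b) := by gcongr; linarith
        _ ≤ f c z / ρ := by gcongr
    have h3 := h1.trans h2
    rwa [div_le_iff₀ hba] at h3
  intro z t ht
  have htm : t ∈ Set.Icc 0 c := ⟨ht.1.le, by have := ht.2; rw [hρ] at this; linarith⟩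
  have ht0m : t₀ ∈ Set.Icc 0 c := ⟨ht0.le, htc.le⟩
  rcases le_total t t₀ with h | h
  · have h1 := hmono z htm ht0m h
    simp only at h1
    rw [abs_of_nonpos (by linarith), abs_of_nonpos (by linarith), neg_sub, neg_sub]
    exact key z t t₀ ht.1.le h (by linarith)
  · have h1 := hmono z ht0m htm h
    simp only at h1
    rw [abs_of_nonneg (by linarith), abs_of_nonneg (by linarith)]
    exact key z t₀ t ht0.le h ht.2.le

/-- Differentiability of `logMean` in the exponent. -/
lemma differentiableAt_logMean {Ω : Type*} [MeasurableSpace Ω] {μ : Measure Ω}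
    [IsProbabilityMeasure μ] {X : Ω → ℝ} {t c : ℝ} (hc : 0 < c) (htc : t < c)
    (hint : ∀ a ≤ c, Integrable (fun z => Real.exp (a * X z)) μ) :
    DifferentiableAt ℝ (fun a => logMean μ a X) t := by
  have hsub : Set.Iic c ⊆ integrableExpSet X μ := fun a ha => hint a ha
  have hin : ∀ a < c, a ∈ interior (integrableExpSet X μ) := fun a ha =>
    interior_mono hsub (by rw [interior_Iic]; exact ha)
  have h0 := hin 0 hc
  -- The case split at exponent `0` is the removable singularity of `cgf a / a`, so analyticity of
  -- the cumulant generating function at `0` settles it.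
  have e : (fun a => logMean μ a X) = dslope (cgf X μ) 0 := by
    ext a
    by_cases ha : a = 0
    · subst ha
      rw [dslope_same, deriv_cgf_zero h0]
      simp [logMean]
    · rw [dslope_of_ne _ ha, slope_def_field, cgf_zero]
      simp only [logMean, if_neg ha, cgf, mgf, sub_zero]
      ring
  rw [e]
  by_cases ht : t = 0
  · subst ht
    obtain ⟨p, hp⟩ := analyticAt_cgf h0
    exact hp.has_fpower_series_dslope_fslope.differentiableAt
  · exact (differentiableAt_dslope_of_ne ht).2 (analyticAt_cgf (hin t htc)).differentiableAt

/-- Jensen gives the upper bound and `exp (-y) ≤ 1 - y + y ^ 2 / 2` for `y ≥ 0` the lower one. They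
control exponents just below `0`, outside the range where convexity in the parameter is established.
-/
lemma integral_sub_le_logMean_neg {Ω : Type*} [MeasurableSpace Ω] {μ : Measure Ω}
    [IsProbabilityMeasure μ] {X : Ω → ℝ} (hX : ∀ z, 0 ≤ X z) (h1 : Integrable X μ)
    (h2 : Integrable (fun z => X z ^ 2) μ) {τ : ℝ} (hτ : 0 < τ)
    (he : Integrable (fun z => Real.exp (-τ * X z)) μ) :
    logMean μ (-τ) X ≤ ∫ z, X z ∂μ ∧
      ∫ z, X z ∂μ - τ * ((∫ z, X z ^ 2 ∂μ) / 2) ≤ logMean μ (-τ) X := by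
  set E := ∫ z, X z ∂μ with hE
  set Q := ∫ z, X z ^ 2 ∂μ with hQ
  have hne : -τ ≠ 0 := by linarith
  have hexp := exp_mul_logMean hne he
  have iτ : Integrable (fun z => τ * X z) μ := h1.const_mul τ
  constructor
  · have key : ∀ z, Real.exp (-τ * E) * (1 + (τ * E - τ * X z)) ≤ Real.exp (-τ * X z) := by
      intro z
      have h3 := Real.add_one_le_exp (τ * E - τ * X z)
      have h4 : Real.exp (-τ * E) * Real.exp (τ * E - τ * X z) = Real.exp (-τ * X z) := by
        rw [← Real.exp_add]; congr 1; ring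
      rw [← h4]
      exact mul_le_mul_of_nonneg_left (by linarith) (Real.exp_pos _).le
    have i1 : Integrable (fun z => τ * E - τ * X z) μ := (integrable_const _).sub iτ
    have i2 : Integrable (fun z => 1 + (τ * E - τ * X z)) μ := (integrable_const _).add i1
    have h5 := integral_mono (i2.const_mul (Real.exp (-τ * E))) he key
    rw [integral_const_mul, integral_add (integrable_const _) i1,
      integral_sub (integrable_const _) iτ, integral_const_mul (r := τ) (f := X), ← hE] at h5
    simp only [integral_const, probReal_univ, smul_eq_mul, one_mul, sub_self, add_zero,
      mul_one] at h5
    rw [← hexp, Real.exp_le_exp] at h5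
    nlinarith
  · have key : ∀ z, Real.exp (-τ * X z) ≤ 1 - τ * X z + τ ^ 2 / 2 * X z ^ 2 := by
      intro z
      have hy : 0 ≤ τ * X z := mul_nonneg hτ.le (hX z)
      have h3 := Real.quadratic_le_exp_of_nonneg hy
      have h4 : Real.exp (-τ * X z) * Real.exp (τ * X z) = 1 := by
        rw [← Real.exp_add]; simp
      have h5 : 0 < Real.exp (-τ * X z) := Real.exp_pos _
      set y := τ * X z with hydef
      have h6 : τ ^ 2 / 2 * X z ^ 2 = y ^ 2 / 2 := by rw [hydef]; ring
      rw [h6]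
      have h7 : Real.exp (-τ * X z) * (1 + y + y ^ 2 / 2) ≤ 1 := by
        exact (mul_le_mul_of_nonneg_left h3 h5.le).trans h4.le
      -- The product equals `1 + y ^ 4 / 4`.
      have h8 : 1 ≤ (1 - y + y ^ 2 / 2) * (1 + y + y ^ 2 / 2) := by nlinarith [sq_nonneg (y ^ 2)]
      have h9 : 0 < 1 + y + y ^ 2 / 2 := by positivity
      exact le_of_mul_le_mul_right (h7.trans h8) h9
    have i1 : Integrable (fun z => 1 - τ * X z) μ := (integrable_const _).sub iτ
    have h5 := integral_mono he (i1.add (h2.const_mul (τ ^ 2 / 2))) key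
    simp only [Pi.add_apply] at h5
    rw [integral_add i1 (h2.const_mul _), integral_sub (integrable_const _) iτ,
      integral_const_mul, integral_const_mul, ← hE, ← hQ] at h5
    simp only [integral_const, probReal_univ, smul_eq_mul, one_mul] at h5
    have h6 := Real.add_one_le_exp (-(τ * E) + τ ^ 2 / 2 * Q)
    have h7 : Real.exp (-τ * logMean μ (-τ) X) ≤ Real.exp (-(τ * E) + τ ^ 2 / 2 * Q) := by
      rw [hexp]; linarith
    rw [Real.exp_le_exp] at h7
    have h8 : τ * (E - τ * (Q / 2)) ≤ τ * logMean μ (-τ) X := by linarith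
    exact le_of_mul_le_mul_left h8 hτ

lemma update_mem_Icc {r : ℕ} {m : Fin r → ℝ} {c : ℝ} (h : ∀ i, m i ∈ Set.Icc 0 c) {j : Fin r}
    {t : ℝ} (ht : t ∈ Set.Icc 0 c) (i : Fin r) : Function.update m j t i ∈ Set.Icc 0 c := by
  rcases eq_or_ne i j with rfl | hij
  · rwa [Function.update_self]
  · rw [Function.update_of_ne hij]; exact h i

section Growth

variable {g : ℝ → ENNReal} {c : ℝ} {Φ : ℝ → ℝ}

/-- Along ordered vectors of parameters, the increment of a chain dominates the sum of its
coordinate increments. -/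
lemma sum_parisiChain_update_sub_le (hc : 1 < c) (hg : Measurable g) (hd : ExpDominated g c 0 Φ)
    (hΦ : IsSmoothConvexSymm Φ) {r : ℕ} {v : Fin r → ℝ≥0}
    (hfin : ∀ w ≤ ∑ i, v i, ∀ x, gaussAvg w g x < ⊤) {m n : Fin r → ℝ}
    (hm : ∀ i, m i ∈ Set.Icc 0 c) (hn : ∀ i, n i ∈ Set.Icc 0 c) (hmn : m ≤ n ∨ n ≤ m) (x : ℝ) :
    ∑ j, (parisiChain r (Function.update m j (n j)) v Φ x - parisiChain r m v Φ x) ≤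
      parisiChain r n v Φ x - parisiChain r m v Φ x := by
  obtain ⟨A, hA, hA0, hAle, hlim⟩ := exists_lipEvenConvex_approx hΦ
  have lim : ∀ a : Fin r → ℝ, (∀ i, a i ∈ Set.Icc 0 c) →
      Filter.Tendsto (fun k => parisiChain r a v (A k) x) Filter.atTop
        (nhds (parisiChain r a v Φ x)) := fun a ha =>
    (tendsto_parisiChain hc hg hd hA hA0 hAle hlim r a v hfin (fun i => (ha i).1)
      (fun i => (ha i).2)).2.2 x
  refine le_of_tendsto_of_tendsto'
    (tendsto_finsetSum Finset.univ fun j _ =>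
      (lim _ (update_mem_Icc hm (hn j))).sub (lim m hm))
    ((lim n hn).sub (lim m hm)) fun k => ?_
  exact sum_update_sub_le (fun a => parisiChain r a v (A k) x)
    (fun a b ha hab j s t hs hst =>
      parisiChain_increasing_differences (hA k) r a b v ha hab j s t hs hst x)
    (fun i => (hm i).1) (fun i => (hn i).1) hmn

/-- Convexity of a chain in each of its parameters. -/
lemma convexOn_parisiChain_update (hc : 1 < c) (hg : Measurable g) (hd : ExpDominated g c 0 Φ)
    (hΦ : IsSmoothConvexSymm Φ) {r : ℕ} {v : Fin r → ℝ≥0}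
    (hfin : ∀ w ≤ ∑ i, v i, ∀ x, gaussAvg w g x < ⊤) {m : Fin r → ℝ}
    (hm : ∀ i, m i ∈ Set.Icc 0 c) (j : Fin r) (x : ℝ) :
    ConvexOn ℝ (Set.Icc 0 c) (fun t => parisiChain r (Function.update m j t) v Φ x) := by
  obtain ⟨A, hA, hA0, hAle, hlim⟩ := exists_lipEvenConvex_approx hΦ
  have lim : ∀ a : Fin r → ℝ, (∀ i, a i ∈ Set.Icc 0 c) →
      Filter.Tendsto (fun k => parisiChain r a v (A k) x) Filter.atTop
        (nhds (parisiChain r a v Φ x)) := fun a ha =>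
    (tendsto_parisiChain hc hg hd hA hA0 hAle hlim r a v hfin (fun i => (ha i).1)
      (fun i => (ha i).2)).2.2 x
  refine ⟨convex_Icc 0 c, fun a ha b hb α β hα hβ hαβ => ?_⟩
  have hab := convex_Icc 0 c ha hb hα hβ hαβ
  refine le_of_tendsto_of_tendsto' (lim _ (update_mem_Icc hm hab))
    (((lim _ (update_mem_Icc hm ha)).const_mul α).add
      ((lim _ (update_mem_Icc hm hb)).const_mul β)) fun k => ?_
  exact (hA k).parisiChain_update_le hα hβ hαβ ha.1 hb.1 r m v (fun i => (hm i).1) j x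

lemma parisiChain_mono (hc : 1 < c) (hg : Measurable g) (hd : ExpDominated g c 0 Φ) :
    ∀ (r : ℕ) (v : Fin r → ℝ≥0), (∀ w ≤ ∑ i, v i, ∀ x, gaussAvg w g x < ⊤) →
      ∀ a b : Fin r → ℝ, (∀ i, a i ∈ Set.Icc 0 c) → (∀ i, b i ∈ Set.Icc 0 c) → a ≤ b →
      ∀ x, parisiChain r a v Φ x ≤ parisiChain r b v Φ x
  | 0, _, _, _, _, _, _, _ => fun _ => le_rfl
  | r + 1, v, hfin, a, b, ha, hb, hab => by
    intro x
    rw [Fin.sum_univ_succ] at hfin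
    have hfin' : ∀ w ≤ ∑ i, Fin.tail v i, ∀ x, gaussAvg w g x < ⊤ :=
      fun w hw => hfin w (hw.trans (le_add_of_nonneg_left zero_le))
    have ih := parisiChain_mono hc hg hd r (Fin.tail v) hfin' (Fin.tail a) (Fin.tail b)
      (fun i => ha i.succ) (fun i => hb i.succ) (fun i => hab i.succ)
    have da := hd.parisiChain hc hg r (Fin.tail a) (Fin.tail v) hfin' (fun i => (ha i.succ).1)
      (fun i => (ha i.succ).2)
    have db := hd.parisiChain hc hg r (Fin.tail b) (Fin.tail v) hfin' (fun i => (hb i.succ).1)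
      (fun i => (hb i.succ).2)
    have ia := fun {t : ℝ} (ht : t ≤ c) => da.expIntegrable hc hg (hfin _ le_rfl) ht x
    have ib := fun {t : ℝ} (ht : t ≤ c) => db.expIntegrable hc hg (hfin _ le_rfl) ht x
    have h1 := logMean_mono (ha 0).1 (ib (ha 0).2) (ia (ha 0).2) (fun z => ih (x + z))
    have h2 := logMean_mono_exponent (ha 0).1 (hab 0) (ib (ha 0).2) (ib (hb 0).2)
    exact h1.trans h2

/-- Partial derivatives at a positive parameter. -/
lemma differentiableAt_parisiChain_of_pos (hc : 1 < c) (hg : Measurable g)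
    (hd : ExpDominated g c 0 Φ) (hΦ : IsSmoothConvexSymm Φ) :
    ∀ (r : ℕ) (v : Fin r → ℝ≥0), (∀ w ≤ ∑ i, v i, ∀ x, gaussAvg w g x < ⊤) →
      ∀ (m : Fin r → ℝ), (∀ i, m i ∈ Set.Icc 0 c) → ∀ j, 0 < m j → m j < c → ∀ x,
      DifferentiableAt ℝ (fun t => parisiChain r (Function.update m j t) v Φ x) (m j)
  | 0, _, _, _, _ => fun j => j.elim0
  | r + 1, v, hfin, m, hm => by
    intro j
    rw [Fin.sum_univ_succ] at hfin
    have hfin' : ∀ w ≤ ∑ i, Fin.tail v i, ∀ x, gaussAvg w g x < ⊤ :=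
      fun w hw => hfin w (hw.trans (le_add_of_nonneg_left zero_le))
    have hm' : ∀ i, Fin.tail m i ∈ Set.Icc 0 c := fun i => hm i.succ
    have hc0 : 0 ≤ c := by linarith
    refine Fin.cases ?_ (fun i => ?_) j
    · intro _ hjc x
      simp only [parisiChain_update_zero, parisiStep_eq_logMean]
      have dom := hd.parisiChain hc hg r (Fin.tail m) (Fin.tail v) hfin' (fun i => (hm' i).1)
        (fun i => (hm' i).2)
      exact differentiableAt_logMean (by linarith) hjc
        (fun a ha => (dom.expIntegrable hc hg (hfin _ le_rfl) ha x).2)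
    · intro hj0 hjc x
      simp only [parisiChain_update_succ]
      set B : ℝ → ℝ → ℝ := fun t => parisiChain r (Function.update (Fin.tail m) i t) (Fin.tail v) Φ
        with hB
      have hBd : ∀ y, DifferentiableAt ℝ (fun t => B t y) (m i.succ) := fun y =>
        differentiableAt_parisiChain_of_pos hc hg hd hΦ r (Fin.tail v) hfin' (Fin.tail m) hm' i
          hj0 hjc y
      have hBm : ∀ t, Measurable (B t) := fun t => measurable_parisiChain hd.meas _ _ _
      have dom : ∀ t ∈ Set.Icc 0 c, ExpDominated g c (∑ i, Fin.tail v i) (B t) := fun t ht =>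
        hd.parisiChain hc hg r _ (Fin.tail v) hfin' (fun k => (update_mem_Icc hm' ht k).1)
          (fun k => (update_mem_Icc hm' ht k).2)
      have hint : ∀ t ∈ Set.Icc 0 c, ExpIntegrable (gaussianReal 0 (v 0)) (m 0)
          (fun z => B t (x + z)) := fun t ht =>
        (dom t ht).expIntegrable hc hg (hfin _ le_rfl) (hm 0).2 x
      have hconv : ∀ y, ConvexOn ℝ (Set.Icc 0 c) (fun t => B t y) := fun y =>
        convexOn_parisiChain_update hc hg hd hΦ hfin' hm' i y
      have hmono : ∀ y, MonotoneOn (fun t => B t y) (Set.Icc 0 c) := fun y s hs t ht hst =>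
        parisiChain_mono hc hg hd r (Fin.tail v) hfin' _ _ (update_mem_Icc hm' hs)
          (update_mem_Icc hm' ht) (update_le_update_iff.2 ⟨hst, fun _ _ => le_rfl⟩) y
      have hmem : m i.succ ∈ Set.Icc 0 c := hm i.succ
      have hcmem : c ∈ Set.Icc 0 c := ⟨hc0, le_rfl⟩
      change DifferentiableAt ℝ (fun t => parisiStep (m 0) (v 0) (B t) x) (m i.succ)
      by_cases h0 : m 0 = 0
      · simp only [parisiStep, if_pos h0]
        exact differentiableAt_integral_of_convex hj0 hjc
          (fun t => (hBm t).comp (measurable_const_add x))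
          (fun t ht z => (dom t ht).nonneg _) (fun z => hconv _) (fun z => hmono _)
          (hint _ hmem).1 (hint _ hcmem).1 (fun z => hBd _)
      · simp only [parisiStep, if_neg h0]
        have hm0 := (hm 0).1
        -- `exp (m 0 * B t)` is again nonnegative, convex and monotone in `t`, so the same criterion
        -- applies before the logarithm is taken.
        suffices h : DifferentiableAt ℝ
            (fun t => ∫ z, Real.exp (m 0 * B t (x + z)) ∂(gaussianReal 0 (v 0))) (m i.succ) from
          (h.log (integral_exp_pos (hint _ hmem).2).ne').const_mul _
        refine differentiableAt_integral_of_convex hj0 hjc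
          (fun t => by have := hBm t; fun_prop)
          (fun t ht z => (Real.exp_pos _).le) (fun z => ?_) (fun z s hs t ht hst => ?_)
          (hint _ hmem).2 (hint _ hcmem).2 (fun z => ((hBd _).const_mul _).exp)
        · refine ⟨convex_Icc 0 c, fun s hs t ht α β hα hβ hαβ => ?_⟩
          have h1 := (hconv (x + z)).2 hs ht hα hβ hαβ
          have h2 := convexOn_exp.2 (Set.mem_univ (m 0 * B s (x + z)))
            (Set.mem_univ (m 0 * B t (x + z))) hα hβ hαβ
          refine le_trans (Real.exp_le_exp.2 ?_) h2
          simp only [smul_eq_mul] at h1 ⊢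
          have h3 := mul_le_mul_of_nonneg_left h1 hm0
          linarith
        · exact Real.exp_le_exp.2 (mul_le_mul_of_nonneg_left (hmono _ hs ht hst) hm0)

/-- Partial derivatives at a vanishing parameter, when the preceding parameters vanish as well. -/
lemma differentiableAt_parisiChain_of_zero (hc : 1 < c) (hg : Measurable g)
    (hd : ExpDominated g c 0 Φ) (hΦ : IsSmoothConvexSymm Φ) :
    ∀ (r : ℕ) (v : Fin r → ℝ≥0), (∀ w ≤ ∑ i, v i, ∀ x, gaussAvg w g x < ⊤) →
      ∀ (m : Fin r → ℝ), (∀ i, m i ∈ Set.Icc 0 c) → ∀ j, (∀ i ≤ j, m i = 0) → ∀ x,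
      DifferentiableAt ℝ (fun t => parisiChain r (Function.update m j t) v Φ x) 0 ∧
      ∀ t ≤ c, |parisiChain r (Function.update m j t) v Φ x
        - parisiChain r (Function.update m j 0) v Φ x|
          ≤ (gaussAvg (∑ i, v i) g x).toReal * |t - 0|
  | 0, _, _, _, _ => fun j => j.elim0
  | r + 1, v, hfin, m, hm => by
    intro j
    rw [Fin.sum_univ_succ] at hfin ⊢
    have hfin' : ∀ w ≤ ∑ i, Fin.tail v i, ∀ x, gaussAvg w g x < ⊤ :=
      fun w hw => hfin w (hw.trans (le_add_of_nonneg_left zero_le))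
    have hfv : ∀ x, gaussAvg (v 0 + ∑ i, Fin.tail v i) g x < ⊤ := hfin _ le_rfl
    have hm' : ∀ i, Fin.tail m i ∈ Set.Icc 0 c := fun i => hm i.succ
    have hc0 : 0 < c := by linarith
    -- The Lipschitz bound is carried along because it dominates the difference quotients in the
    -- next average. Its constant is itself a Gaussian average, so averaging it only adds the
    -- variance.
    change _ → ∀ x, _ ∧ ∀ t ≤ c, _ ≤ (gaussAvg (v 0 + ∑ i, Fin.tail v i) g x).toReal * |t - 0|
    refine Fin.cases ?_ (fun i => ?_) j
    · intro _ x
      have dom := hd.parisiChain hc hg r (Fin.tail m) (Fin.tail v) hfin' (fun i => (hm' i).1)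
        (fun i => (hm' i).2)
      have hint := fun a (ha : a ≤ c) => dom.expIntegrable hc hg hfv ha x
      have hconv := convexOn_parisiChain_update hc hg hd hΦ
        (r := r + 1) (v := v) (by rw [Fin.sum_univ_succ]; exact hfin) hm 0 x
      simp only [parisiChain_update_zero] at hconv ⊢
      set F := parisiChain r (Fin.tail m) (Fin.tail v) Φ
      refine ⟨differentiableAt_logMean hc0 hc0 (fun a ha => (hint a ha).2), fun t ht => ?_⟩
      set J := (gaussAvg (v 0 + ∑ i, Fin.tail v i) g x).toReal with hJ
      have hJexp : ∫ z, Real.exp (c * F (x + z)) ∂(gaussianReal 0 (v 0)) ≤ J := by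
        rw [integral_eq_lintegral_of_nonneg_ae
          (Filter.Eventually.of_forall fun z => (Real.exp_pos _).le)
          (hint c le_rfl).2.aestronglyMeasurable]
        exact ENNReal.toReal_mono (hfv x).ne (dom.lintegral_le hg x)
      rw [sub_zero]
      rcases lt_trichotomy t 0 with h | rfl | h
      -- For `t < 0` the increment is at most `|t|` times half the second moment, and the second
      -- moment is at most `2 * J`.
      · have hsq : ∀ y, F y ^ 2 ≤ 2 * Real.exp (c * F y) := fun y => by
          have h1 := dom.nonneg y
          have h2 := Real.quadratic_le_exp_of_nonneg (mul_nonneg hc0.le h1)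
          have h3 : F y ^ 2 ≤ (c * F y) ^ 2 := pow_le_pow_left₀ h1 (by nlinarith) 2
          have h4 : 0 ≤ c * F y := mul_nonneg hc0.le h1
          linarith
        have hmF := dom.meas
        have i2 : Integrable (fun z => F (x + z) ^ 2) (gaussianReal 0 (v 0)) := by
          refine ((hint c le_rfl).2.const_mul 2).mono'
            (Measurable.aestronglyMeasurable (by fun_prop))
            (Filter.Eventually.of_forall fun z => ?_)
          rw [Real.norm_eq_abs, abs_of_nonneg (sq_nonneg _)]
          exact hsq _
        have hQ : ∫ z, F (x + z) ^ 2 ∂(gaussianReal 0 (v 0)) ≤ 2 * J := by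
          have := integral_mono i2 ((hint c le_rfl).2.const_mul 2) (fun z => hsq (x + z))
          rw [integral_const_mul] at this
          linarith
        have hτ : 0 < -t := by linarith
        obtain ⟨u1, u2⟩ := integral_sub_le_logMean_neg (μ := gaussianReal 0 (v 0))
          (X := fun z => F (x + z)) (fun z => dom.nonneg _) (hint 0 hc0.le).1 i2 hτ
          (by rw [neg_neg]; exact (hint t ht).2)
        rw [neg_neg] at u1 u2
        have e0 : parisiStep 0 (v 0) F x = ∫ z, F (x + z) ∂(gaussianReal 0 (v 0)) := by
          simp [parisiStep]
        rw [e0, parisiStep_eq_logMean, abs_of_nonpos (by linarith), abs_of_neg h]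
        have := mul_le_mul_of_nonneg_left hQ hτ.le
        linarith
      · simp
      · have hb := logMean_mono_exponent le_rfl h.le (hint 0 hc0.le) (hint t ht)
        change parisiStep 0 (v 0) F x ≤ parisiStep t (v 0) F x at hb
        rw [abs_of_nonneg (by linarith), abs_of_pos h]
        -- For `0 < t ≤ c` the chord over `[0, c]` bounds the increment, since `t = (1 - t / c) * 0
        -- + (t / c) * c`.
        have w0 : 0 ≤ 1 - t / c := by rw [sub_nonneg, div_le_one hc0]; exact ht
        have w1 : 0 ≤ t / c := by positivity
        have m0 : (0 : ℝ) ∈ Set.Icc 0 c := ⟨le_rfl, hc0.le⟩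
        have mc : c ∈ Set.Icc 0 c := ⟨hc0.le, le_rfl⟩
        have h1 := hconv.2 m0 mc w0 w1 (by ring)
        simp only [smul_eq_mul, mul_zero, zero_add] at h1
        rw [div_mul_cancel₀ _ hc0.ne'] at h1
        have n0 := (dom.parisiStep hc hg hfv le_rfl hc0.le).nonneg x
        have dc := dom.parisiStep hc hg hfv hc0.le le_rfl
        have nc : parisiStep c (v 0) F x ≤ J := by
          refine (dc.le_exp hc x).trans ?_
          exact (ENNReal.ofReal_le_iff_le_toReal (hfv x).ne).1 (dc.le x)
        have nc0 := dc.nonneg x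
        have h2 : t / c ≤ t := div_le_self h.le hc.le
        have h3 : 0 ≤ t / c := by positivity
        have h4 : 0 ≤ t / c * parisiStep 0 (v 0) F x := mul_nonneg h3 n0
        have h5 : t / c * parisiStep c (v 0) F x ≤ t * J := mul_le_mul h2 nc nc0 h.le
        linarith
    · intro hz x
      -- The outer step is a plain expectation, linear in the inner chain, so it preserves the
      -- Lipschitz bound even for negative `t`.
      have h0 : m 0 = 0 := hz 0 (Fin.zero_le _)
      simp only [parisiChain_update_succ]
      set B : ℝ → ℝ → ℝ := fun t => parisiChain r (Function.update (Fin.tail m) i t) (Fin.tail v) Φ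
        with hB
      have ih := differentiableAt_parisiChain_of_zero hc hg hd hΦ r (Fin.tail v) hfin' (Fin.tail m)
        hm' i (fun k hk => hz k.succ (Fin.succ_le_succ_iff.2 hk))
      have hBm : ∀ t, Measurable (B t) := fun t => measurable_parisiChain hd.meas _ _ _
      have dom := hd.parisiChain hc hg r _ (Fin.tail v) hfin'
        (fun k => (update_mem_Icc (j := i) hm' (t := 0) ⟨le_rfl, hc0.le⟩ k).1)
        (fun k => (update_mem_Icc (j := i) hm' (t := 0) ⟨le_rfl, hc0.le⟩ k).2)
      have hint := (dom.expIntegrable hc hg hfv hc0.le x).1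
      set S := ∑ i, Fin.tail v i
      have hJm : AEMeasurable (fun z => gaussAvg S g (x + z)) (gaussianReal 0 (v 0)) :=
        ((measurable_gaussAvg S hg).comp (measurable_const_add x)).aemeasurable
      have hJl : ∫⁻ z, gaussAvg S g (x + z) ∂(gaussianReal 0 (v 0)) = gaussAvg (v 0 + S) g x := by
        rw [← gaussAvg_gaussAvg _ _ hg]; rfl
      have hJi : Integrable (fun z => (gaussAvg S g (x + z)).toReal) (gaussianReal 0 (v 0)) :=
        integrable_toReal_of_lintegral_ne_top hJm (by rw [hJl]; exact (hfv x).ne)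
      have hJint : ∫ z, (gaussAvg S g (x + z)).toReal ∂(gaussianReal 0 (v 0))
          = (gaussAvg (v 0 + S) g x).toReal := by
        rw [integral_toReal hJm (Filter.Eventually.of_forall fun z => hfin' _ le_rfl _), hJl]
      change DifferentiableAt ℝ (fun t => parisiStep (m 0) (v 0) (B t) x) 0 ∧ ∀ t ≤ c,
        |parisiStep (m 0) (v 0) (B t) x - parisiStep (m 0) (v 0) (B 0) x| ≤ _
      simp only [parisiStep, if_pos h0]
      refine ⟨differentiableAt_integral_of_lip (s := Set.Iio c) (Iio_mem_nhds hc0)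
        (fun t => (hBm t).comp (measurable_const_add x)) hint
        (fun z t ht => (ih (x + z)).2 t (le_of_lt ht)) hJi (fun z => (ih (x + z)).1),
        fun t ht => ?_⟩
      have hdiff : ∀ z, |B t (x + z) - B 0 (x + z)| ≤ (gaussAvg S g (x + z)).toReal * |t - 0| :=
        fun z => (ih (x + z)).2 t ht
      have iB : Integrable (fun z => B t (x + z) - B 0 (x + z)) (gaussianReal 0 (v 0)) :=
        (hJi.mul_const _).mono' (((hBm t).comp (measurable_const_add x)).sub
          ((hBm 0).comp (measurable_const_add x))).aestronglyMeasurable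
          (Filter.Eventually.of_forall hdiff)
      have iBt : Integrable (fun z => B t (x + z)) (gaussianReal 0 (v 0)) := by
        refine (iB.add hint).congr (Filter.Eventually.of_forall fun z => ?_)
        simp [hB]
      rw [← integral_sub iBt hint, ← hJint, ← integral_mul_const]
      exact abs_integral_le_of_abs_le (hJi.mul_const _) hdiff

end Growth

/-! ### Total variance, moderate growth under shifts, and the conclusion. -/

lemma parisiRec_eq_parisiChain (Φ ξ : ℝ → ℝ) :
    ∀ (r : ℕ) (m : Fin r → ℝ) (q : Fin (r + 1) → ℝ), parisiRec Φ ξ r m q =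
      parisiChain r m (fun i => Real.toNNReal (deriv ξ (q i.succ) - deriv ξ (q i.castSucc))) Φ
  | 0, _, _ => rfl
  | r + 1, m, q => by
    rw [parisiRec, parisiRec_eq_parisiChain Φ ξ r, parisiChain_succ]
    rfl

/-- Monotonicity makes every increment nonnegative, so the truncation is never active and the sum
telescopes. -/
lemma sum_toNNReal_sub {f : ℝ → ℝ} (hf : Monotone f) :
    ∀ (r : ℕ) (q : Fin (r + 1) → ℝ), Monotone q →
      ∑ i : Fin r, Real.toNNReal (f (q i.succ) - f (q i.castSucc))
        = Real.toNNReal (f (q (Fin.last r)) - f (q 0))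
  | 0, q, _ => by simp
  | r + 1, q, hq => by
    rw [Fin.sum_univ_castSucc]
    have ih := sum_toNNReal_sub hf r (fun i => q i.castSucc)
      (fun i j h => hq (Fin.castSucc_le_castSucc_iff.2 h))
    have e : ∑ i : Fin r, Real.toNNReal (f (q i.castSucc.succ) - f (q i.castSucc.castSucc))
        = Real.toNNReal (f (q (Fin.last r).castSucc) - f (q (0 : Fin (r + 1)).castSucc)) := ih
    have h1 : 0 ≤ f (q (Fin.last r).castSucc) - f (q (0 : Fin (r + 1)).castSucc) :=
      sub_nonneg.2 (hf (hq (Fin.zero_le _)))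
    have h2 : 0 ≤ f (q (Fin.last r).succ) - f (q (Fin.last r).castSucc) :=
      sub_nonneg.2 (hf (hq (Fin.le_last _)))
    rw [e, ← Real.toNNReal_add h1 h2]
    congr 1
    simp

/-- Moderate growth survives translations and smaller variances, for a smaller constant. -/
lemma ModerateGrowth.exists_gaussAvg_lt_top {Φ ξ : ℝ → ℝ} (hΦ : IsSmoothConvexSymm Φ)
    (h : ModerateGrowth Φ ξ) : ∃ c : ℝ, 1 < c ∧
      ExpDominated (fun y => ENNReal.ofReal (Real.exp (c * Φ y))) c 0 Φ ∧
      ∀ w ≤ Real.toNNReal (deriv ξ 1), ∀ x,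
        gaussAvg w (fun y => ENNReal.ofReal (Real.exp (c * Φ y))) x < ⊤ := by
  obtain ⟨c₀, hc₀, hint⟩ := h
  set S := Real.toNNReal (deriv ξ 1)
  -- The gap between `c` and `c₀` pays for the tilt `exp (x / S * z)` produced by a shift.
  set c := (1 + c₀) / 2 with hc
  have hc1 : 1 < c := by rw [hc]; linarith
  have hcc : c < c₀ := by rw [hc]; linarith
  have hm : Measurable Φ := hΦ.smooth.continuous.measurable
  have hnn : ∀ x, 0 ≤ Φ x := fun x => by
    rw [← hΦ.zero]; exact absMono_of_even_convex hΦ.symm hΦ.convex 0 x (by simp)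
  have hconv : ConvexOn ℝ Set.univ (fun y => Real.exp (c * Φ y)) := by
    refine ⟨convex_univ, fun x _ y _ α β hα hβ hαβ => ?_⟩
    have h1 := hΦ.convex.2 (Set.mem_univ x) (Set.mem_univ y) hα hβ hαβ
    have h2 := convexOn_exp.2 (Set.mem_univ (c * Φ x)) (Set.mem_univ (c * Φ y)) hα hβ hαβ
    refine le_trans (Real.exp_le_exp.2 ?_) h2
    simp only [smul_eq_mul] at h1 ⊢
    have h3 := mul_le_mul_of_nonneg_left h1 (by linarith : 0 ≤ c)
    linarith
  have hg : Measurable (fun y => ENNReal.ofReal (Real.exp (c * Φ y))) := by fun_prop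
  have hshift : ∀ x, Integrable (fun z => Real.exp (c * Φ (x + z))) (gaussianReal 0 S) := by
    intro x
    rcases eq_or_ne S 0 with h0 | h0
    · rw [h0, gaussianReal_zero_var]
      exact integrable_dirac (by simp)
    · apply integrable_gaussianReal_shift h0 x (f := fun z => Real.exp (c * Φ z))
      set θ := c / c₀ with hθ
      have hθ0 : 0 < θ := div_pos (by linarith) (by linarith)
      have hθ1 : 0 < 1 - θ := by
        rw [sub_pos, hθ, div_lt_one (by linarith)]; exact hcc
      -- Weighted Young inequality with `θ = c / c₀`: the tilted integrand is at most `θ * exp (c₀ *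
      -- Φ)` plus `1 - θ` times an exponential of a linear function.
      have i1 := (hint.const_mul θ).add
        ((integrable_exp_mul_gaussianReal (μ := 0) (v := S) (x / S / (1 - θ))).const_mul (1 - θ))
      refine i1.mono' (Measurable.aestronglyMeasurable (by fun_prop))
        (Filter.Eventually.of_forall fun z => ?_)
      rw [← Real.exp_add, Real.norm_eq_abs, abs_of_pos (Real.exp_pos _)]
      have h2 := convexOn_exp.2 (Set.mem_univ (c₀ * Φ z)) (Set.mem_univ (x / S / (1 - θ) * z))
        hθ0.le hθ1.le (by ring)
      refine le_trans (le_of_eq ?_) h2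
      congr 1
      simp only [smul_eq_mul]
      have hc0 : c₀ ≠ 0 := by linarith
      have hθ' : θ * c₀ = c := by rw [hθ]; exact div_mul_cancel₀ _ hc0
      have h4 : (1 - θ) * (x / S / (1 - θ) * z) = x / S * z := by
        have := hθ1.ne'
        rw [← mul_assoc, mul_div_cancel₀ _ this]
      rw [h4, ← mul_assoc, hθ']
  refine ⟨c, hc1, ⟨hm, hnn, fun x => ?_⟩, fun w hw x => ?_⟩
  · simp [gaussAvg]
  · have hle : gaussAvg w (fun y => ENNReal.ofReal (Real.exp (c * Φ y))) x
        ≤ gaussAvg S (fun y => ENNReal.ofReal (Real.exp (c * Φ y))) x := by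
      -- A smaller variance is handled by Jensen's inequality for the missing part `S - w`.
      have e : S = w + (S - w) := (add_tsub_cancel_of_le hw).symm
      rw [e, ← gaussAvg_gaussAvg _ _ hg]
      exact lintegral_mono fun z =>
        le_gaussAvg _ hconv (by fun_prop) (fun _ => (Real.exp_pos _).le) (x + z)
    refine hle.trans_lt ?_
    have := (hshift x).2
    rwa [hasFiniteIntegral_iff_ofReal
      (Filter.Eventually.of_forall fun z => (Real.exp_pos _).le)] at this

theorem theorem1 (Φ ξ : ℝ → ℝ) (hΦ : IsSmoothConvexSymm Φ) (hξ : IsSmoothConvexSymm ξ)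
    (hgrowth : ModerateGrowth Φ ξ) (h : ℝ) (k : ℕ) (hk : 1 ≤ k)
    (q : Fin (k + 2) → ℝ) (hq : IsParisiQ k q)
    (m n : Fin (k + 1) → ℝ) (hm : IsParisiM k m) (hn : IsParisiM k n)
    (hmn : (∀ j, n j ≤ m j) ∨ (∀ j, m j ≤ n j)) :
    (∀ j, DifferentiableAt ℝ
      (fun t : ℝ => parisiP Φ ξ h k (Function.update m j t) q) (m j)) ∧
    parisiP Φ ξ h k n q - parisiP Φ ξ h k m q ≥
      ∑ j, parisiPartial Φ ξ h k m q j * (n j - m j) := by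
  obtain ⟨c, hc, hdom, hfin⟩ := hgrowth.exists_gaussAvg_lt_top hΦ
  have hg : Measurable (fun y => ENNReal.ofReal (Real.exp (c * Φ y))) := by
    have := hdom.meas; fun_prop
  have hξd : Differentiable ℝ ξ := hξ.smooth.differentiable (by simp)
  have hξm : Monotone (deriv ξ) := fun x y hxy =>
    hξ.convex.monotoneOn_deriv (fun x _ => hξd x) (Set.mem_univ x) (Set.mem_univ y) hxy
  have hξ0 : deriv ξ 0 = 0 := by
    have h1 := deriv_comp_neg ξ 0
    rw [show (fun x => ξ (-x)) = ξ from funext hξ.symm, neg_zero] at h1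
    linarith
  set v : Fin (k + 1) → ℝ≥0 :=
    fun i => Real.toNNReal (deriv ξ (q i.succ) - deriv ξ (q i.castSucc)) with hv
  -- As `ξ' 0 = 0`, the step variances add up to exactly the variance in the growth assumption.
  have hsum : ∑ i, v i = Real.toNNReal (deriv ξ 1) := by
    rw [hv, sum_toNNReal_sub hξm (k + 1) q hq.2.1, hq.1, hq.2.2, hξ0, sub_zero]
  rw [← hsum] at hfin
  have hP : ∀ a : Fin (k + 1) → ℝ, parisiP Φ ξ h k a q = parisiChain (k + 1) a v Φ h := fun a => by
    rw [parisiP, parisiRec_eq_parisiChain]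
  have mem : ∀ {a : Fin (k + 1) → ℝ}, IsParisiM k a → ∀ i, 0 ≤ a i ∧ a i ≤ 1 := fun ha i =>
    ⟨ha.1 ▸ ha.2.1 (Fin.zero_le i), ha.2.2 ▸ ha.2.1 (Fin.le_last i)⟩
  have hmc : ∀ i, m i ∈ Set.Icc 0 c := fun i => ⟨(mem hm i).1, (mem hm i).2.trans hc.le⟩
  have hnc : ∀ i, n i ∈ Set.Icc 0 c := fun i => ⟨(mem hn i).1, (mem hn i).2.trans hc.le⟩
  have hdiff : ∀ j, DifferentiableAt ℝ
      (fun t : ℝ => parisiChain (k + 1) (Function.update m j t) v Φ h) (m j) := fun j => by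
    -- If `m j = 0`, monotonicity forces all earlier parameters to vanish; otherwise `0 < m j ≤ 1 <
    -- c` is interior.
    rcases (mem hm j).1.eq_or_lt with hj | hj
    · have := (differentiableAt_parisiChain_of_zero hc hg hdom hΦ (k + 1) v hfin m hmc j
        (fun i hi => le_antisymm ((hm.2.1 hi).trans hj.symm.le) (mem hm i).1) h).1
      rwa [← hj]
    · exact differentiableAt_parisiChain_of_pos hc hg hdom hΦ (k + 1) v hfin m hmc j hj
        ((mem hm j).2.trans_lt hc) h
  simp only [parisiPartial, hP]
  refine ⟨hdiff, le_trans (Finset.sum_le_sum fun j _ => ?_)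
    (sum_parisiChain_update_sub_le hc hg hdom hΦ hfin hmc hnc hmn.symm h)⟩
  have hconv := convexOn_parisiChain_update hc hg hdom hΦ hfin hmc j h
  have e : parisiChain (k + 1) m v Φ h
      = parisiChain (k + 1) (Function.update m j (m j)) v Φ h := by rw [Function.update_eq_self]
  -- The tangent at `m j` lies below the convex function of the `j`-th parameter, on either side.
  rcases lt_trichotomy (m j) (n j) with hlt | heq | hlt
  · have h1 := hconv.le_slope_of_hasDerivAt (hmc j) (hnc j) hlt (hdiff j).hasDerivAt
    rw [slope_def_field, le_div_iff₀ (sub_pos.2 hlt)] at h1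
    rw [e]
    exact h1
  · rw [← heq, Function.update_eq_self]
    simp
  · have h1 := hconv.slope_le_of_hasDerivAt (hnc j) (hmc j) hlt (hdiff j).hasDerivAt
    rw [slope_def_field, div_le_iff₀ (sub_pos.2 hlt)] at h1
    rw [e]
    linarith
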